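/- Scalars are real or complex, and all index sets are countable (possibly finite). **Conventions.** A quasi-norm on a vector space $X$ is a map $\|\cdot\|\colon X\to[0,\infty)$ that is positive off $0$, absolutely homogeneous, and satisfies $\|f+g\|\le\kappa(\|f\|+\|g\|)$ for some $\kappa\ge1$; the least such $\kappa\ge 1$ is the modulus of concavity. A quasi-Banach space is a complete quasi-normed space, and $[x_n\colon n]$ denotes a closed linear span. A family $(x_n)_{n\in N}$ in $X$ is an unconditional basic sequence if every $f\in[x_n\colon n\in N]$ has a unique expansion $f=\sum_n a_nx_n$ with unconditional convergence. It is an unconditional basis of $X$ if moreover $[x_n\colon n\in N]=X$; then $x_n^*(f):=a_n$ and $\operatorname{supp}(f):=\{n\colon x_n^*(f)\ne0\}$. It is $K$-unconditional ($K\ge1$) if $\|\sum_n a_nx_n\|\le K\|\sum_n b_nx_n\|$ for all finitely supported scalar families with $|a_n|\le|b_n|$ for all $n$. A family is normalized if all its members have quasi-norm $1$. Families $(x_n)_{n\in N}$ in $X$ and $(y_n)_{n\in N}$ in $Y$ are $C$-equivalent if there is an isomorphic embedding $T\colon[x_n\colon n\in N]\to Y$ with $T(x_n)=y_n$ for all $n$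 and $\|T\|,\|T^{-1}\|\le C$. Let $\mathcal X=(x_n)_{n\in N}$ be an unconditional basis of a quasi-Banach space $X$. * An unconditional basic sequence $(y_m)_{m\in M}$ in $X$ is *well $C$-complemented* if there are bounded linear functionals $y_m^*$ on $X$ with $y_m^*(y_k)=\delta_{m,k}$ such that $P(f)=\sum_m y_m^*(f)\,y_m$ (unconditionally convergent series) defines a bounded linear map on $X$; $\|\sum_{m\in S}y_m^*(f)\,y_m\|\le C$ for all $S\subseteq M$ and all $f$ with $\|f\|\le1$; the sets $\operatorname{supp}(y_m)$ are finite and pairwise disjoint; and $\{n\colon y_m^*(x_n)\neq0\}\subseteq\operatorname{supp}(y_m)$ for all $m$. * For $\mathcal X$ normalized and $\eta\colon[1,\infty)\to[1,\infty)$, $\mathcal X$ is *uniformly universal for well complemented block basic sequences with function $\eta$* if for every $C\ge1$ and every normalized well $C$-complemented sequence $(y_m)_{m\in M}$ there is a map $\pi\colon M\to N$ with $\pi(m)\in\operatorname{supp}(y_m)$ for all $m$ such that $(y_m)_{m\in M}$ is $\eta(C)$-equivalent to $(x_{\pi(m)})_{m\in M}$. It is *uniformly universal for well complemented block basic sequences*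 if this holds for some $\eta$. * $\mathcal X$ is *strongly absolute* if for every $R>0$ there is $C>0$ such that for all $f\in X$ $$\sum_n|x_n^*(f)|\,\|x_n\|\le\max\Bigl\{C\sup_n|x_n^*(f)|\,\|x_n\|,\ \frac{\|f\|}{R}\Bigr\}.$$ A *sequence space* on $J$ is a quasi-Banach space $\mathcal L$ of scalar families indexed by $J$ such that $b\in\mathcal L$ and $|a_j|\le|b_j|$ for all $j$ imply $a\in\mathcal L$ and $\|a\|\le\|b\|$, and such that the unit vectors $e_j$ belong to $\mathcal L$ and have quasi-norm $1$. For quasi-Banach spaces $X_j$ ($j\in J$) with uniformly bounded moduli of concavity, $(\bigoplus_jX_j)_{\mathcal L}$ is the space of all $f=(f_j)\in\prod_jX_j$ with $(\|f_j\|)_j\in\mathcal L$, with quasi-norm $\|f\|=\|(\|f_j\|)_j\|_{\mathcal L}$. For families $\mathcal X_j=(x_{j,n})_{n\in N_j}$ in $X_j$, $(\bigoplus_j\mathcal X_j)_{\mathcal L}$ is the family $(L_j(x_{j,n}))_{j\in J,\,n\in N_j}$, where $L_j\colon X_j\to(\bigoplus_iX_i)_{\mathcal L}$ is the canonical embedding.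 **Theorem.** Let $\mathcal L$ be a sequence space on $J$ whose unit vector system $(e_j)_{j\in J}$ is a strongly absolute unconditional basis of $\mathcal L$. For each $j\in J$ let $\mathcal X_j$ be a normalized $K$-unconditional basis of a quasi-Banach space $X_j$ with modulus of concavity at most $\kappa$, where $K$ and $\kappa$ do not depend on $j$. Suppose that there is a function $\eta\colon[1,\infty)\to[1,\infty)$ such that, for every $j\in J$, $\mathcal X_j$ is uniformly universal for well complemented block basic sequences with function $\eta$. Then $(\bigoplus_{j}\mathcal X_j)_{\mathcal L}$ is a normalized unconditional basis of the quasi-Banach space $(\bigoplus_{j}X_j)_{\mathcal L}$, and it is uniformly universal for well complemented block basic sequences. -/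

import Mathlib

open Filter Topology

noncomputable section

namespace QuasiBanach

/-- A quasi-norm on a vector space over the real or complex field. -/
structure QuasiNorm (𝕜 : Type*) (E : Type*) [RCLike 𝕜] [AddCommGroup E] [Module 𝕜 E] where
  toFun : E → ℝ
  nonneg' : ∀ f, 0 ≤ toFun f
  pos' : ∀ f, f ≠ 0 → 0 < toFun f
  smul' : ∀ (t : 𝕜) (f : E), toFun (t • f) = ‖t‖ * toFun f
  add_le' : ∃ κ : ℝ, 1 ≤ κ ∧ ∀ f g, toFun (f + g) ≤ κ * (toFun f + toFun g)

instance {𝕜 E : Type*} [RCLike 𝕜] [AddCommGroup E] [Module 𝕜 E] :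
    CoeFun (QuasiNorm 𝕜 E) (fun _ => E → ℝ) := ⟨QuasiNorm.toFun⟩

namespace QuasiNorm

variable {𝕜 E F N M : Type*} [RCLike 𝕜] [AddCommGroup E] [Module 𝕜 E]
  [AddCommGroup F] [Module 𝕜 F]

theorem map_zero (q : QuasiNorm 𝕜 E) : q 0 = 0 := by
  have h := q.smul' 0 0
  simpa using h

/-- The modulus of concavity of the quasi-norm is at most `κ`. -/
def ModulusLE (q : QuasiNorm 𝕜 E) (κ : ℝ) : Prop :=
  ∀ f g, q (f + g) ≤ κ * (q f + q g)

/-- Completeness (every Cauchy sequence converges): the space is a quasi-Banach space. -/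
def IsComplete (q : QuasiNorm 𝕜 E) : Prop :=
  ∀ u : ℕ → E, (∀ ε > 0, ∃ n₀, ∀ m ≥ n₀, ∀ n ≥ n₀, q (u m - u n) < ε) →
    ∃ f, Tendsto (fun n => q (u n - f)) atTop (𝓝 0)

/-- The series `∑ v i` converges unconditionally to `f`: the net of its finite partial sums
converges to `f` in the topology of the quasi-norm. -/
def HasUncondSum (q : QuasiNorm 𝕜 E) (v : N → E) (f : E) : Prop :=
  Tendsto (fun A : Finset N => q (∑ i ∈ A, v i - f)) atTop (𝓝 0)

/-- The closed linear span `[x n : n]` of a family of vectors. -/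
def closedSpan (q : QuasiNorm 𝕜 E) (x : N → E) : Submodule 𝕜 E where
  carrier := {f | ∀ ε > 0, ∃ g ∈ Submodule.span 𝕜 (Set.range x), q (f - g) < ε}
  zero_mem' := by
    intro ε hε
    exact ⟨0, Submodule.zero_mem _, by simpa [q.map_zero] using hε⟩
  add_mem' := by
    intro a b ha hb ε hε
    obtain ⟨κ, hκ, h⟩ := q.add_le'
    have hκ0 : 0 < κ := by linarith
    obtain ⟨g, hg, hg'⟩ := ha (ε / (2 * κ)) (by positivity)
    obtain ⟨g₂, hg₂, hg₂'⟩ := hb (ε / (2 * κ)) (by positivity)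
    refine ⟨g + g₂, Submodule.add_mem _ hg hg₂, ?_⟩
    have e : a + b - (g + g₂) = (a - g) + (b - g₂) := by abel
    rw [e]
    calc q ((a - g) + (b - g₂)) ≤ κ * (q (a - g) + q (b - g₂)) := h _ _
      _ < κ * (ε / (2 * κ) + ε / (2 * κ)) := by
        apply mul_lt_mul_of_pos_left _ hκ0
        linarith
      _ = ε := by field_simp; ring
  smul_mem' := by
    intro c a ha ε hε
    have hc : 0 < ‖c‖ + 1 := by positivity
    obtain ⟨g, hg, hg'⟩ := ha (ε / (‖c‖ + 1)) (by positivity)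
    refine ⟨c • g, Submodule.smul_mem _ c hg, ?_⟩
    rw [← smul_sub, q.smul']
    calc ‖c‖ * q (a - g) ≤ (‖c‖ + 1) * q (a - g) :=
          mul_le_mul_of_nonneg_right (by linarith) (q.nonneg' _)
      _ < (‖c‖ + 1) * (ε / (‖c‖ + 1)) := mul_lt_mul_of_pos_left hg' hc
      _ = ε := by field_simp

theorem mem_closedSpan (q : QuasiNorm 𝕜 E) (x : N → E) (n : N) : x n ∈ q.closedSpan x := by
  intro ε hε
  exact ⟨x n, Submodule.subset_span ⟨n, rfl⟩, by simpa [q.map_zero] using hε⟩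

/-- `x` is an unconditional basic sequence: every vector of its closed linear span has a unique
expansion as an unconditionally convergent series. -/
def IsUnconditionalBasicSequence (q : QuasiNorm 𝕜 E) (x : N → E) : Prop :=
  ∀ f ∈ q.closedSpan x, ∃! a : N → 𝕜, q.HasUncondSum (fun n => a n • x n) f

/-- `x` is an unconditional basis of the whole space. -/
def IsUnconditionalBasis (q : QuasiNorm 𝕜 E) (x : N → E) : Prop :=
  q.IsUnconditionalBasicSequence x ∧ q.closedSpan x = ⊤

/-- The lattice unconditionality inequality with constant `K`. -/
def IsUnconditionalWith (q : QuasiNorm 𝕜 E) (x : N → E) (K : ℝ) : Prop :=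
  1 ≤ K ∧ ∀ a b : N →₀ 𝕜, (∀ n, ‖a n‖ ≤ ‖b n‖) →
    q (a.sum fun n t => t • x n) ≤ K * q (b.sum fun n t => t • x n)

/-- All the vectors of the family have quasi-norm one. -/
def IsNormalized (q : QuasiNorm 𝕜 E) (x : N → E) : Prop := ∀ n, q (x n) = 1

open Classical in
/-- The coefficients `(xₙ*(f))ₙ` of `f` with respect to `x` (zero if `f` has no expansion, which
does not happen when `x` is an unconditional basis). -/
def coeff (q : QuasiNorm 𝕜 E) (x : N → E) (f : E) : N → 𝕜 :=
  if h : ∃ a : N → 𝕜, q.HasUncondSum (fun n => a n • x n) f then h.choose else 0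

/-- The support of a vector with respect to `x`. -/
def supp (q : QuasiNorm 𝕜 E) (x : N → E) (f : E) : Set N := {n | q.coeff x f n ≠ 0}

/-- The support of a functional with respect to `x`. -/
def dualSupp (x : N → E) (φ : E →ₗ[𝕜] 𝕜) : Set N := {n | φ (x n) ≠ 0}

/-- The families `x` and `y` are `C`-equivalent: there is an isomorphic embedding `T` of `[x]`
with `T (x n) = y n` for all `n`, `‖T‖ ≤ C` and `‖T⁻¹‖ ≤ C`. -/
def AreEquivalentWith (p : QuasiNorm 𝕜 E) (q : QuasiNorm 𝕜 F) (x : N → E) (y : N → F)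
    (C : ℝ) : Prop :=
  ∃ T : p.closedSpan x →ₗ[𝕜] F,
    (∀ n, T ⟨x n, p.mem_closedSpan x n⟩ = y n) ∧
    ∀ f : p.closedSpan x, q (T f) ≤ C * p (f : E) ∧ p (f : E) ≤ C * q (T f)

/-- `y'` is a sequence of projecting functionals for `y`: the functionals are bounded,
biorthogonal to `y`, and `P f = ∑ y'ₘ(f) yₘ` defines a bounded linear map
(necessarily a projection onto `[y]`). -/
structure IsProjecting (q : QuasiNorm 𝕜 E) (y : M → E) (y' : M → E →ₗ[𝕜] 𝕜) : Prop where
  bounded : ∀ m, ∃ B : ℝ, ∀ f, ‖y' m f‖ ≤ B * q f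
  apply_self : ∀ m, y' m (y m) = 1
  apply_ne : ∀ m n, m ≠ n → y' m (y n) = 0
  projection : ∃ P : E →ₗ[𝕜] E, (∃ B : ℝ, ∀ f, q (P f) ≤ B * q f) ∧
    ∀ f, q.HasUncondSum (fun m => y' m f • y m) (P f)

/-- The set of numbers `‖∑_{m ∈ S} y'ₘ(f) yₘ‖`, where `S` runs over all sets of indices and `f`
over the closed unit ball; its supremum is the constant `Γ[y, y']`. -/
def gammaSet (q : QuasiNorm 𝕜 E) (y : M → E) (y' : M → E →ₗ[𝕜] 𝕜) : Set ℝ :=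
  {r | ∃ (S : Set M) (f g : E), q f ≤ 1 ∧
    q.HasUncondSum (fun m : S => y' m f • y m) g ∧ r = q g}

/-- `y` is a well `C`-complemented unconditional basic sequence with respect to the basis `x`. -/
def IsWellComplementedWith (q : QuasiNorm 𝕜 E) (x : N → E) (y : M → E) (C : ℝ) : Prop :=
  q.IsUnconditionalBasicSequence y ∧
  ∃ y' : M → E →ₗ[𝕜] 𝕜, q.IsProjecting y y' ∧
    (∀ m, dualSupp x (y' m) ⊆ q.supp x (y m)) ∧
    (∀ m, (q.supp x (y m)).Finite) ∧
    (∀ m n, m ≠ n → Disjoint (q.supp x (y m)) (q.supp x (y n))) ∧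
    C ∈ upperBounds (q.gammaSet y y')

/-- `x` is uniformly universal for well complemented block basic sequences with function `η`.
Index sets of sequences are countable, so it is enough to let them range over `Type`. -/
def IsUniformlyUniversalWith (q : QuasiNorm 𝕜 E) (x : N → E) (η : ℝ → ℝ) : Prop :=
  (∀ C, 1 ≤ C → 1 ≤ η C) ∧
  ∀ C : ℝ, 1 ≤ C → ∀ (M : Type) [Countable M] (y : M → E),
    q.IsNormalized y → q.IsWellComplementedWith x y C →
    ∃ π : M → N, (∀ m, π m ∈ q.supp x (y m)) ∧
      AreEquivalentWith q q y (fun m => x (π m)) (η C)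

/-- `x` is uniformly universal for well complemented block basic sequences. -/
def IsUniformlyUniversal (q : QuasiNorm 𝕜 E) (x : N → E) : Prop :=
  ∃ η : ℝ → ℝ, q.IsUniformlyUniversalWith x η

/-- `x` is a strongly absolute unconditional basis. The sum and the supremum are taken in
`[0, ∞]`. -/
def IsStronglyAbsolute (q : QuasiNorm 𝕜 E) (x : N → E) : Prop :=
  q.IsUnconditionalBasis x ∧
  ∀ R : ℝ, 0 < R → ∃ C : ℝ, 0 < C ∧ ∀ f : E,
    ∑' n, ENNReal.ofReal (‖q.coeff x f n‖ * q (x n)) ≤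
      max (ENNReal.ofReal C * ⨆ n, ENNReal.ofReal (‖q.coeff x f n‖ * q (x n)))
        (ENNReal.ofReal (q f / R))

end QuasiNorm

open Classical in
/-- A sequence space on `J`: a quasi-Banach lattice of scalar families indexed by `J` in which the
unit vectors are normalized. -/
structure SequenceSpace (𝕜 : Type*) (J : Type*) [RCLike 𝕜] where
  carrier : Submodule 𝕜 (J → 𝕜)
  qnorm : QuasiNorm 𝕜 carrier
  complete : qnorm.IsComplete
  mem_of_le : ∀ a b : J → 𝕜, (∀ j, ‖a j‖ ≤ ‖b j‖) → b ∈ carrier → a ∈ carrier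
  qnorm_le : ∀ a b : carrier, (∀ j, ‖(a : J → 𝕜) j‖ ≤ ‖(b : J → 𝕜) j‖) → qnorm a ≤ qnorm b
  single_mem : ∀ j, Pi.single j (1 : 𝕜) ∈ carrier
  qnorm_single : ∀ j, qnorm ⟨Pi.single j (1 : 𝕜), single_mem j⟩ = 1

open Classical in
/-- The unit vector system of a sequence space. -/
def SequenceSpace.unitVector {𝕜 J : Type*} [RCLike 𝕜] (L : SequenceSpace 𝕜 J) (j : J) :
    L.carrier := ⟨Pi.single j 1, L.single_mem j⟩

section DirectSum

variable {𝕜 J : Type*} [RCLike 𝕜] {X : J → Type*} [∀ j, AddCommGroup (X j)]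
  [∀ j, Module 𝕜 (X j)]

/-- The family of quasi-norms `(‖f j‖)ⱼ`, as a family of scalars. -/
def normFamily (q : ∀ j, QuasiNorm 𝕜 (X j)) (f : ∀ j, X j) : J → 𝕜 :=
  fun j => ((q j (f j) : ℝ) : 𝕜)

theorem norm_normFamily (q : ∀ j, QuasiNorm 𝕜 (X j)) (f : ∀ j, X j) (j : J) :
    ‖normFamily q f j‖ = q j (f j) := by
  simp [normFamily, abs_of_nonneg ((q j).nonneg' _)]

theorem norm_normFamily_add_le (q : ∀ j, QuasiNorm 𝕜 (X j)) {κ : ℝ}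
    (hκ : ∀ j, (q j).ModulusLE κ) (f g : ∀ j, X j) (j : J) :
    ‖normFamily q (f + g) j‖ ≤ ‖((κ : 𝕜) • (normFamily q f + normFamily q g)) j‖ := by
  rw [norm_normFamily]
  have h0 : 0 ≤ q j (f j) + q j (g j) := add_nonneg ((q j).nonneg' _) ((q j).nonneg' _)
  have h1 : ((κ : 𝕜) • (normFamily q f + normFamily q g)) j
      = ((κ * (q j (f j) + q j (g j)) : ℝ) : 𝕜) := by
    simp [normFamily]
  rw [h1, RCLike.norm_ofReal]
  exact (hκ j _ _).trans (le_abs_self _)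

/-- The direct sum `(⨁ⱼ X j)_L` of quasi-normed spaces with uniformly bounded moduli of concavity:
the families `f` with `(‖f j‖)ⱼ ∈ L`. -/
def directSum (L : SequenceSpace 𝕜 J) (q : ∀ j, QuasiNorm 𝕜 (X j)) (κ : ℝ)
    (hκ : ∀ j, (q j).ModulusLE κ) : Submodule 𝕜 (∀ j, X j) where
  carrier := {f | normFamily q f ∈ L.carrier}
  zero_mem' := by
    have h : normFamily q (0 : ∀ j, X j) = (0 : J → 𝕜) := by
      funext j
      simp [normFamily, QuasiNorm.map_zero]
    simp only [Set.mem_ofPred_eq, h]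
    exact L.carrier.zero_mem
  add_mem' := by
    intro f g hf hg
    exact L.mem_of_le _ _ (norm_normFamily_add_le q hκ f g)
      (L.carrier.smul_mem _ (L.carrier.add_mem hf hg))
  smul_mem' := by
    intro c f hf
    refine L.mem_of_le _ (c • normFamily q f) (fun j => ?_) (L.carrier.smul_mem c hf)
    rw [norm_normFamily, Pi.smul_apply, Pi.smul_apply, norm_smul, norm_normFamily, (q j).smul']

/-- The quasi-norm `‖f‖ = ‖(‖f j‖)ⱼ‖_L` of the direct sum. -/
def directSumNorm (L : SequenceSpace 𝕜 J) (q : ∀ j, QuasiNorm 𝕜 (X j)) (κ : ℝ)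
    (hκ : ∀ j, (q j).ModulusLE κ) : QuasiNorm 𝕜 (directSum L q κ hκ) where
  toFun f := L.qnorm ⟨normFamily q f, f.2⟩
  nonneg' f := L.qnorm.nonneg' _
  pos' f hf := by
    apply L.qnorm.pos'
    intro h
    apply hf
    apply Subtype.ext
    funext j
    by_contra hj
    have h1 : normFamily q f j = 0 := congrFun (congrArg Subtype.val h) j
    have h2 := norm_normFamily q (f : ∀ j, X j) j
    rw [h1, norm_zero] at h2
    exact absurd h2 ((q j).pos' _ hj).ne
  smul' t f := by
    rw [← L.qnorm.smul']
    apply le_antisymm <;> apply L.qnorm_le <;> intro j <;>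
      simp only [norm_normFamily, Submodule.coe_smul, Pi.smul_apply, norm_smul, (q j).smul'] <;>
      exact le_rfl
  add_le' := by
    obtain ⟨κ₂, h1, h2⟩ := L.qnorm.add_le'
    refine ⟨max 1 (|κ| * κ₂), le_max_left _ _, fun f g => ?_⟩
    have h3 : L.qnorm ⟨normFamily q (f + g : directSum L q κ hκ), (f + g).2⟩ ≤
        L.qnorm ((κ : 𝕜) • (⟨normFamily q f, f.2⟩ + ⟨normFamily q g, g.2⟩ : L.carrier)) :=
      L.qnorm_le _ _ (fun j => norm_normFamily_add_le q hκ f g j)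
    rw [L.qnorm.smul', RCLike.norm_ofReal] at h3
    refine h3.trans ?_
    calc |κ| * L.qnorm (⟨normFamily q f, f.2⟩ + ⟨normFamily q g, g.2⟩ : L.carrier)
        ≤ |κ| * (κ₂ * (L.qnorm ⟨normFamily q f, f.2⟩ + L.qnorm ⟨normFamily q g, g.2⟩)) :=
          mul_le_mul_of_nonneg_left (h2 _ _) (abs_nonneg _)
      _ = (|κ| * κ₂) * (L.qnorm ⟨normFamily q f, f.2⟩ + L.qnorm ⟨normFamily q g, g.2⟩) := by ring
      _ ≤ _ := mul_le_mul_of_nonneg_right (le_max_right _ _)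
          (add_nonneg (L.qnorm.nonneg' _) (L.qnorm.nonneg' _))

open Classical in
theorem single_mem_directSum (L : SequenceSpace 𝕜 J) (q : ∀ j, QuasiNorm 𝕜 (X j)) (κ : ℝ)
    (hκ : ∀ j, (q j).ModulusLE κ) (j : J) (v : X j) : Pi.single j v ∈ directSum L q κ hκ := by
  refine L.mem_of_le _ (((q j v : ℝ) : 𝕜) • (Pi.single j (1 : 𝕜) : J → 𝕜)) (fun k => ?_)
    (L.carrier.smul_mem _ (L.single_mem j))
  rw [norm_normFamily]
  by_cases hk : k = j
  · subst hk
    simp [le_abs_self]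
  · simp [hk, QuasiNorm.map_zero]

open Classical in
/-- The canonical embedding of the `j`-th summand, on vectors. -/
def directSumIncl (L : SequenceSpace 𝕜 J) (q : ∀ j, QuasiNorm 𝕜 (X j)) (κ : ℝ)
    (hκ : ∀ j, (q j).ModulusLE κ) (j : J) (v : X j) : directSum L q κ hκ :=
  ⟨Pi.single j v, single_mem_directSum L q κ hκ j v⟩

/-- The family `(⨁ⱼ x j)_L` of all vectors `x j n`, seen in the direct sum. -/
def directSumBasis (L : SequenceSpace 𝕜 J) (q : ∀ j, QuasiNorm 𝕜 (X j)) (κ : ℝ)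
    (hκ : ∀ j, (q j).ModulusLE κ) {N : J → Type*} (x : ∀ j, N j → X j) :
    (Σ j, N j) → directSum L q κ hκ :=
  fun i => directSumIncl L q κ hκ i.1 (x i.1 i.2)

end DirectSum

end QuasiBanach

end

/-! Let `y` be a normalized well `C`-complemented block sequence of the direct sum, with functionals
`y'`. For fixed `m`, the scalars `b j = y' m (L_j ((y m) j))` sum to `1`, and `|b j| ≤ C ‖(y m) j‖`,
so `b` lies in `L` with quasi-norm at most `C`. Strong absoluteness then forbids that all `b j` be
small: some `j = i m` satisfies `|b j| ≥ δ`, where `δ` depends only on `C`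
(`exists_le_norm_apply_incl`).

Hence `y m` may be replaced by its component in the single summand `i m`. The lattice property
bounds combinations of components by those of the `y m`; conversely, the partial-sum operators of
`y`, applied to a combination of components, return the `y m` with coefficients multiplied by
numbers of modulus at least `δ` (`sum_component_equiv`).

For fixed `j`, the components of the blocks with `i m = j`, once normalized, are well complemented
in `X j` with a constant independent of `j` (`component_isWellComplementedWith`), so the hypothesis
makes them uniformly equivalent to basis vectors of `x j` (`exists_component_map`). Since the
quasi-norm of the direct sum is monotone in the quasi-norms of the coordinates, these equivalences
glue together (`exists_map`). -/

noncomputable section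
namespace QuasiBanach
namespace QuasiNorm

variable {𝕜 E F N M : Type*} [RCLike 𝕜] [AddCommGroup E] [Module 𝕜 E]
  [AddCommGroup F] [Module 𝕜 F]

/-! ### Quasi-norms and unconditionally convergent series. -/

theorem le_of_forall_pos_le_add_mul {a b D : ℝ} (h : ∀ ε > 0, a ≤ b + D * ε) : a ≤ b := by
  have h1 : Tendsto (fun ε : ℝ => b + D * ε) (𝓝[>] 0) (𝓝 (b + D * 0)) :=
    (Continuous.tendsto (by fun_prop) 0).mono_left nhdsWithin_le_nhds
  rw [mul_zero, add_zero] at h1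
  exact ge_of_tendsto h1 (eventually_nhdsWithin_of_forall h)

theorem ModulusLE.mono {q : QuasiNorm 𝕜 E} {κ κ' : ℝ} (h : q.ModulusLE κ) (hκ : κ ≤ κ') :
    q.ModulusLE κ' := fun f g =>
  (h f g).trans (mul_le_mul_of_nonneg_right hκ (add_nonneg (q.nonneg' _) (q.nonneg' _)))

theorem map_neg (q : QuasiNorm 𝕜 E) (f : E) : q (-f) = q f := by
  have h := q.smul' (-1) f
  simpa using h

theorem map_sub_comm (q : QuasiNorm 𝕜 E) (f g : E) : q (f - g) = q (g - f) := by
  rw [← q.map_neg, neg_sub]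

theorem eq_zero_of_map_le_zero (q : QuasiNorm 𝕜 E) {f : E} (h : q f ≤ 0) : f = 0 := by
  by_contra hf
  exact absurd (q.pos' f hf) (not_lt.2 h)

theorem ModulusLE.sub_le {q : QuasiNorm 𝕜 E} {κ : ℝ} (h : q.ModulusLE κ) (f g k : E) :
    q (f - k) ≤ κ * (q (f - g) + q (g - k)) := by
  simpa using h (f - g) (g - k)

theorem ModulusLE.le_sub {q : QuasiNorm 𝕜 E} {κ : ℝ} (h : q.ModulusLE κ) (f g : E) :
    q f ≤ κ * (q (f - g) + q g) := by
  simpa using h (f - g) g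

theorem hasUncondSum_iff {q : QuasiNorm 𝕜 E} {v : N → E} {f : E} :
    q.HasUncondSum v f ↔
      ∀ ε > 0, ∃ A₀ : Finset N, ∀ A, A₀ ⊆ A → q (∑ i ∈ A, v i - f) < ε := by
  classical
  unfold HasUncondSum
  rw [Metric.tendsto_atTop]
  simp [abs_of_nonneg (q.nonneg' _)]

theorem HasUncondSum.unique {q : QuasiNorm 𝕜 E} {v : N → E} {f g : E}
    (hf : q.HasUncondSum v f) (hg : q.HasUncondSum v g) : f = g := by
  classical
  obtain ⟨κ, h1, hκ⟩ := q.add_le'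
  rw [← sub_eq_zero]
  apply q.eq_zero_of_map_le_zero
  apply le_of_forall_pos_le_add_mul (D := 2 * κ)
  intro ε hε
  obtain ⟨A, hA⟩ := hasUncondSum_iff.1 hf ε hε
  obtain ⟨B, hB⟩ := hasUncondSum_iff.1 hg ε hε
  have h2 := hA (A ∪ B) Finset.subset_union_left
  have h3 := hB (A ∪ B) Finset.subset_union_right
  have h4 := ModulusLE.sub_le hκ f (∑ i ∈ A ∪ B, v i) g
  rw [q.map_sub_comm f (∑ i ∈ A ∪ B, v i)] at h4
  nlinarith

theorem HasUncondSum.add {q : QuasiNorm 𝕜 E} {v w : N → E} {f g : E}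
    (hf : q.HasUncondSum v f) (hg : q.HasUncondSum w g) :
    q.HasUncondSum (fun n => v n + w n) (f + g) := by
  obtain ⟨κ, h1, hκ⟩ := q.add_le'
  have h2 := (Tendsto.add hf hg).const_mul κ
  simp only [add_zero, mul_zero] at h2
  refine squeeze_zero (fun _ => q.nonneg' _) (fun A => ?_) h2
  rw [Finset.sum_add_distrib, add_sub_add_comm]
  exact hκ _ _

theorem HasUncondSum.map {p : QuasiNorm 𝕜 E} {q : QuasiNorm 𝕜 F} {v : N → E} {f : E}
    (hf : p.HasUncondSum v f) (φ : E →ₗ[𝕜] F) {B : ℝ} (hB : ∀ g, q (φ g) ≤ B * p g) :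
    q.HasUncondSum (fun n => φ (v n)) (φ f) := by
  have h2 := Tendsto.const_mul B hf
  simp only [mul_zero] at h2
  refine squeeze_zero (fun _ => q.nonneg' _) (fun A => ?_) h2
  rw [← map_sum, ← map_sub]
  exact hB _

theorem HasUncondSum.smul {q : QuasiNorm 𝕜 E} {v : N → E} {f : E}
    (hf : q.HasUncondSum v f) (c : 𝕜) : q.HasUncondSum (fun n => c • v n) (c • f) := by
  have h2 := Tendsto.const_mul ‖c‖ hf
  rw [mul_zero] at h2
  refine squeeze_zero (fun _ => q.nonneg' _) (fun A => ?_) h2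
  rw [← Finset.smul_sum, ← smul_sub, q.smul']

theorem hasUncondSum_sum (q : QuasiNorm 𝕜 E) {v : N → E} {A : Finset N}
    (h : ∀ n ∉ A, v n = 0) : q.HasUncondSum v (∑ n ∈ A, v n) := by
  refine hasUncondSum_iff.2 fun ε hε => ⟨A, fun B hB => ?_⟩
  rw [Finset.sum_subset hB fun n _ hn => h n hn, sub_self, q.map_zero]
  exact hε

/-- The norm of the scalar field as a quasi-norm. -/
def scalar (𝕜 : Type*) [RCLike 𝕜] : QuasiNorm 𝕜 𝕜 where
  toFun t := ‖t‖
  nonneg' := norm_nonneg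
  pos' _ h := norm_pos_iff.2 h
  smul' := norm_smul
  add_le' := ⟨1, le_rfl, fun f g => by simpa using norm_add_le f g⟩

theorem HasUncondSum.functional_eq {q : QuasiNorm 𝕜 E} {v : N → E} {f : E}
    (hf : q.HasUncondSum v f) {φ : E →ₗ[𝕜] 𝕜} {B : ℝ} (hB : ∀ g, ‖φ g‖ ≤ B * q g) (m : N)
    (hm : ∀ n, n ≠ m → φ (v n) = 0) : φ f = φ (v m) := by
  have h1 := hf.map (q := scalar 𝕜) φ hB
  have h2 := hasUncondSum_sum (scalar 𝕜) (v := fun n => φ (v n)) (A := {m})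
    (fun n hn => hm n (by simpa using hn))
  rw [Finset.sum_singleton] at h2
  exact h1.unique h2

theorem HasUncondSum.exists_tail {q : QuasiNorm 𝕜 E} {v : N → E} {f : E}
    (hf : q.HasUncondSum v f) {ε : ℝ} (hε : 0 < ε) :
    ∃ A : Finset N, ∀ B, Disjoint A B → q (∑ n ∈ B, v n) < ε := by
  classical
  obtain ⟨κ, h1, hκ⟩ := q.add_le'
  have h0 : 0 < κ := by linarith
  obtain ⟨A, hA⟩ := hasUncondSum_iff.1 hf (ε / (2 * κ)) (by positivity)
  refine ⟨A, fun B hB => ?_⟩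
  have h2 := hA A subset_rfl
  have h3 := hA (A ∪ B) Finset.subset_union_left
  have h4 := ModulusLE.sub_le hκ (∑ i ∈ A ∪ B, v i) f (∑ i ∈ A, v i)
  rw [Finset.sum_union hB, add_sub_cancel_left, q.map_sub_comm f] at h4
  rw [Finset.sum_union hB] at h3
  refine h4.trans_lt ?_
  calc _ < κ * (ε / (2 * κ) + ε / (2 * κ)) := by
        apply mul_lt_mul_of_pos_left _ h0
        linarith
    _ = ε := by field_simp; ring

/-- Completeness concerns sequences, whereas the sums run along the net of finite sets. The finite
sets `A k` witnessing smallness `1/(k+1)` of the tails are accumulated into `s k`; the sums over `s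
k` form a Cauchy sequence, and any finite set containing `A k` has a sum close to theirs. -/
theorem IsComplete.exists_hasUncondSum {q : QuasiNorm 𝕜 E} (hq : q.IsComplete) {v : N → E}
    (h : ∀ ε > 0, ∃ A : Finset N, ∀ B, Disjoint A B → q (∑ n ∈ B, v n) < ε) :
    ∃ f, q.HasUncondSum v f := by
  classical
  obtain ⟨κ, h1, hκ⟩ := q.add_le'
  have h0 : 0 < κ := by linarith
  have hstep : ∀ k : ℕ, ∃ A : Finset N, ∀ B, Disjoint A B →
      q (∑ n ∈ B, v n) < 1 / ((k : ℝ) + 1) := fun k => h _ (by positivity)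
  choose A hA using hstep
  let s : ℕ → Finset N := fun k => (Finset.range (k + 1)).biUnion A
  have hs : ∀ k m, k ≤ m → A k ⊆ s m := fun k m hkm =>
    Finset.subset_biUnion_of_mem A (Finset.mem_range.2 (by omega))
  have hsd : ∀ (k : ℕ) (B C : Finset N), A k ⊆ B → A k ⊆ C →
      q (∑ n ∈ B, v n - ∑ n ∈ C, v n) ≤ κ * (2 * (1 / ((k : ℝ) + 1))) := by
    intro k B C hB hC
    have e : ∑ n ∈ B, v n - ∑ n ∈ C, v n = ∑ n ∈ B \ A k, v n - ∑ n ∈ C \ A k, v n := by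
      rw [← Finset.sum_sdiff hB, ← Finset.sum_sdiff hC]; abel
    have hb := hA k (B \ A k) Finset.disjoint_sdiff
    have hc := hA k (C \ A k) Finset.disjoint_sdiff
    rw [e, sub_eq_add_neg]
    refine (hκ _ _).trans ?_
    rw [q.map_neg]
    exact mul_le_mul_of_nonneg_left (by linarith) h0.le
  have hlim : ∀ ε > 0, ∃ k : ℕ, κ * (2 * (1 / ((k : ℝ) + 1))) < ε := by
    intro ε hε
    obtain ⟨k, hk⟩ := exists_nat_one_div_lt (show 0 < ε / (2 * κ) by positivity)
    refine ⟨k, ?_⟩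
    rw [lt_div_iff₀ (by positivity)] at hk
    linarith
  obtain ⟨f, hf⟩ := hq (fun k => ∑ n ∈ s k, v n) (by
    intro ε hε
    obtain ⟨k, hk⟩ := hlim ε hε
    exact ⟨k, fun m hm n hn => (hsd k _ _ (hs k m hm) (hs k n hn)).trans_lt hk⟩)
  refine ⟨f, hasUncondSum_iff.2 fun ε hε => ?_⟩
  obtain ⟨k, hk⟩ := hlim (ε / (2 * κ)) (by positivity)
  refine ⟨A k, fun B hB => ?_⟩
  obtain ⟨m, hm⟩ := eventually_atTop.1
    ((tendsto_order.1 hf).2 (ε / (2 * κ)) (by positivity))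
  have h2 := hm (max m k) (le_max_left _ _)
  have h3 := (hsd k B _ hB (hs k _ (le_max_right m k))).trans_lt hk
  refine (ModulusLE.sub_le hκ _ (∑ n ∈ s (max m k), v n) _).trans_lt ?_
  calc _ < κ * (ε / (2 * κ) + ε / (2 * κ)) := mul_lt_mul_of_pos_left (add_lt_add h3 h2) h0
    _ = ε := by field_simp; ring

/-- A quasi-norm need not be continuous, so a bound on partial sums passes to the limit only at the
cost of a factor `κ`. -/
theorem HasUncondSum.le_of_forall_le {q : QuasiNorm 𝕜 E} {κ b : ℝ} (hκ : q.ModulusLE κ)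
    {v : N → E} {f : E} (hf : q.HasUncondSum v f) (h0 : 0 ≤ κ)
    (h : ∀ A : Finset N, q (∑ n ∈ A, v n) ≤ b) : q f ≤ κ * b := by
  apply le_of_forall_pos_le_add_mul (D := κ)
  intro ε hε
  obtain ⟨A, hA⟩ := hasUncondSum_iff.1 hf ε hε
  have h2 := hA A subset_rfl
  have h3 := hκ.le_sub f (∑ n ∈ A, v n)
  rw [q.map_sub_comm] at h3
  have h4 := h A
  nlinarith

/-! ### Coefficients and the lattice property of unconditional bases. -/

section Basis

variable {q : QuasiNorm 𝕜 E} {x : N → E}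

theorem hasUncondSum_coeff (hx : q.IsUnconditionalBasis x) (f : E) :
    q.HasUncondSum (fun n => q.coeff x f n • x n) f := by
  have h : ∃ a : N → 𝕜, q.HasUncondSum (fun n => a n • x n) f :=
    (hx.1 f (by rw [hx.2]; trivial)).exists
  rw [coeff, dif_pos h]
  exact h.choose_spec

theorem coeff_eq (hx : q.IsUnconditionalBasis x) {f : E} {a : N → 𝕜}
    (ha : q.HasUncondSum (fun n => a n • x n) f) : q.coeff x f = a :=
  (hx.1 f (by rw [hx.2]; trivial)).unique (hasUncondSum_coeff hx f) ha

theorem coeff_add (hx : q.IsUnconditionalBasis x) (f g : E) :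
    q.coeff x (f + g) = q.coeff x f + q.coeff x g := by
  apply coeff_eq hx
  simpa [add_smul] using (hasUncondSum_coeff hx f).add (hasUncondSum_coeff hx g)

theorem coeff_smul (hx : q.IsUnconditionalBasis x) (c : 𝕜) (f : E) :
    q.coeff x (c • f) = c • q.coeff x f := by
  apply coeff_eq hx
  simpa [mul_smul] using (hasUncondSum_coeff hx f).smul c

/-- The coefficients with respect to an unconditional basis, as a linear map. -/
def coeffMap (hx : q.IsUnconditionalBasis x) : E →ₗ[𝕜] (N → 𝕜) where
  toFun := q.coeff x
  map_add' := coeff_add hx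
  map_smul' := coeff_smul hx

theorem coeff_sum (hx : q.IsUnconditionalBasis x) (S : Finset M) (w : M → E) (n : N) :
    q.coeff x (∑ m ∈ S, w m) n = ∑ m ∈ S, q.coeff x (w m) n := by
  have h := congrFun (map_sum (coeffMap hx) w S) n
  rwa [Finset.sum_apply] at h

theorem coeff_basis [DecidableEq N] (hx : q.IsUnconditionalBasis x) (n : N) :
    q.coeff x (x n) = Pi.single n 1 := by
  apply coeff_eq hx
  have h := hasUncondSum_sum q (v := fun k => (Pi.single n (1 : 𝕜) : N → 𝕜) k • x k) (A := {n})
    (fun k hk => by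
      rw [Finset.mem_singleton] at hk
      simp [hk])
  simpa using h

/-- Coefficientwise domination implies domination of the quasi-norms, up to the constant `D`. -/
def IsLatticeWith (q : QuasiNorm 𝕜 E) (x : N → E) (D : ℝ) : Prop :=
  ∀ f g, (∀ n, ‖q.coeff x f n‖ ≤ ‖q.coeff x g n‖) → q f ≤ D * q g

/-- Both expansions are truncated to a common finite set, where the inequality with constant `K`
applies. One factor `κ` is lost in passing from `f` to its truncation, another in passing from the
truncation of `g` to `g`. -/
theorem IsUnconditionalWith.isLatticeWith {κ K : ℝ} (hx : q.IsUnconditionalBasis x)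
    (hK : q.IsUnconditionalWith x K) (hκ : q.ModulusLE κ) (h1 : 1 ≤ κ) :
    q.IsLatticeWith x (κ ^ 2 * K) := by
  classical
  intro f g hfg
  have hK1 := hK.1
  apply le_of_forall_pos_le_add_mul (D := κ + κ ^ 2 * K)
  intro ε hε
  obtain ⟨A, hA⟩ := hasUncondSum_iff.1 (hasUncondSum_coeff hx f) ε hε
  obtain ⟨B, hB⟩ := hasUncondSum_iff.1 (hasUncondSum_coeff hx g) ε hε
  have h2 := hA (A ∪ B) Finset.subset_union_left
  have h3 := hB (A ∪ B) Finset.subset_union_right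
  have h4 := hK.2 (Finsupp.indicator (A ∪ B) fun n _ => q.coeff x f n)
    (Finsupp.indicator (A ∪ B) fun n _ => q.coeff x g n) (fun n => by
      by_cases hn : n ∈ A ∪ B
      · simpa [Finsupp.indicator_of_mem hn] using hfg n
      · simp [Finsupp.indicator_of_notMem hn])
  rw [Finsupp.sum_indicator_index _ (by simp), Finsupp.sum_indicator_index _ (by simp)] at h4
  have h5 := hκ.le_sub f (∑ n ∈ A ∪ B, q.coeff x f n • x n)
  have h6 := hκ.le_sub (∑ n ∈ A ∪ B, q.coeff x g n • x n) g
  rw [q.map_sub_comm] at h5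
  have hκK : 0 ≤ κ * K := by positivity
  calc q f ≤ κ * (ε + K * (κ * (ε + q g))) := by
        refine h5.trans (mul_le_mul_of_nonneg_left (add_le_add h2.le (h4.trans ?_)) (by linarith))
        refine mul_le_mul_of_nonneg_left (h6.trans ?_) (by linarith)
        exact mul_le_mul_of_nonneg_left (by linarith) (by linarith)
    _ = _ := by ring

/-- By disjointness, at each index `n` at most one `w' m`, hence at most one `w m`, contributes to
the sum. -/
theorem IsLatticeWith.sum_le {D : ℝ} (hD : q.IsLatticeWith x D) (hx : q.IsUnconditionalBasis x)
    (S : Finset M) {w w' : M → E}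
    (hw : ∀ m n, ‖q.coeff x (w m) n‖ ≤ ‖q.coeff x (w' m) n‖)
    (hd : ∀ m k n, m ≠ k → q.coeff x (w' m) n ≠ 0 → q.coeff x (w' k) n = 0) :
    q (∑ m ∈ S, w m) ≤ D * q (∑ m ∈ S, w' m) := by
  apply hD
  intro n
  rw [coeff_sum hx, coeff_sum hx]
  by_cases h : ∃ m ∈ S, q.coeff x (w' m) n ≠ 0
  · obtain ⟨m, hm, hmn⟩ := h
    have h1 : ∀ k ∈ S, k ≠ m → q.coeff x (w' k) n = 0 := fun k _ hk => hd m k n hk.symm hmn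
    have h2 : ∀ k ∈ S, k ≠ m → q.coeff x (w k) n = 0 := fun k hk hkm => by
      have := hw k n
      rw [h1 k hk hkm, norm_zero] at this
      exact norm_le_zero_iff.1 this
    rw [Finset.sum_eq_single_of_mem m hm h1, Finset.sum_eq_single_of_mem m hm h2]
    exact hw m n
  · push Not at h
    rw [Finset.sum_eq_zero (f := fun m => q.coeff x (w m) n) fun m hm => ?_]
    · simp
    · have := hw m n
      rw [h m hm, norm_zero] at this
      exact norm_le_zero_iff.1 this

end Basis

/-! ### Equivalence of families from estimates on finite sums. -/

section Equivalence

/-- The sum quasi-norm on a product. -/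
def prod (p : QuasiNorm 𝕜 E) (q : QuasiNorm 𝕜 F) : QuasiNorm 𝕜 (E × F) where
  toFun f := p f.1 + q f.2
  nonneg' f := add_nonneg (p.nonneg' _) (q.nonneg' _)
  pos' f hf := by
    by_contra h
    have h1 := p.nonneg' f.1
    have h2 := q.nonneg' f.2
    exact hf (Prod.ext (p.eq_zero_of_map_le_zero (by linarith))
      (q.eq_zero_of_map_le_zero (by linarith)))
  smul' t f := by simp [p.smul', q.smul', mul_add]
  add_le' := by
    obtain ⟨κ, h1, hκ⟩ := p.add_le'
    obtain ⟨κ', h1', hκ'⟩ := q.add_le'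
    refine ⟨max κ κ', le_max_of_le_left h1, fun f g => ?_⟩
    have h2 := ModulusLE.mono hκ (le_max_left κ κ') f.1 g.1
    have h3 := ModulusLE.mono hκ' (le_max_right κ κ') f.2 g.2
    simp only [Prod.fst_add, Prod.snd_add]
    linarith

/-- The embedding is constructed through its graph `G`, the closed span of the pairs `(x n, y n)` in
the product. The two-sided estimate extends from the span to `G` with two losses of `κ`. -/
theorem areEquivalentWith_of_finite {p : QuasiNorm 𝕜 E} {q : QuasiNorm 𝕜 F} {x : N → E}
    {y : N → F} {κ C : ℝ} (hq : q.IsComplete) (hpκ : p.ModulusLE κ) (hqκ : q.ModulusLE κ)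
    (h1 : 1 ≤ κ) (hC : 0 < C)
    (h : ∀ (S : Finset N) (a : N → 𝕜),
      q (∑ n ∈ S, a n • y n) ≤ C * p (∑ n ∈ S, a n • x n) ∧
      p (∑ n ∈ S, a n • x n) ≤ C * q (∑ n ∈ S, a n • y n)) :
    AreEquivalentWith p q x y (κ ^ 2 * C) := by
  have h0 : 0 < κ := by linarith
  let G := (p.prod q).closedSpan fun n => (x n, y n)
  have hspan : ∀ g ∈ Submodule.span 𝕜 (Set.range fun n => (x n, y n)),
      q g.2 ≤ C * p g.1 ∧ p g.1 ≤ C * q g.2 := by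
    intro g hg
    obtain ⟨a, rfl⟩ := Finsupp.mem_span_range_iff_exists_finsupp.1 hg
    simpa [Finsupp.sum, Prod.fst_sum, Prod.snd_sum] using h a.support a
  have hG : ∀ g ∈ G, q g.2 ≤ κ ^ 2 * C * p g.1 ∧ p g.1 ≤ κ ^ 2 * C * q g.2 := by
    intro g hg
    constructor <;> apply le_of_forall_pos_le_add_mul (D := κ + κ ^ 2 * C) <;> intro ε hε <;>
      obtain ⟨s, hs, hgs⟩ := hg ε hε
    all_goals
      replace hgs : p (g.1 - s.1) + q (g.2 - s.2) < ε := hgs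
      have e1 := p.nonneg' (g.1 - s.1)
      have e2 := q.nonneg' (g.2 - s.2)
      have h2 := hspan s hs
    · have h3 := hqκ.le_sub g.2 s.2
      have h4 := hpκ.le_sub s.1 g.1
      rw [p.map_sub_comm] at h4
      calc q g.2 ≤ κ * (ε + C * (κ * (ε + p g.1))) := by
            refine h3.trans (mul_le_mul_of_nonneg_left (add_le_add (by linarith)
              (h2.1.trans (mul_le_mul_of_nonneg_left (h4.trans ?_) hC.le))) h0.le)
            exact mul_le_mul_of_nonneg_left (by linarith) h0.le
        _ = _ := by ring
    · have h3 := hpκ.le_sub g.1 s.1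
      have h4 := hqκ.le_sub s.2 g.2
      rw [q.map_sub_comm] at h4
      calc p g.1 ≤ κ * (ε + C * (κ * (ε + q g.2))) := by
            refine h3.trans (mul_le_mul_of_nonneg_left (add_le_add (by linarith)
              (h2.2.trans (mul_le_mul_of_nonneg_left (h4.trans ?_) hC.le))) h0.le)
            exact mul_le_mul_of_nonneg_left (by linarith) h0.le
        _ = _ := by ring
  -- `G` projects onto the whole of `[x]`: approximants of `f` in the span of `x` lift to pairs
  -- whose second entries are Cauchy, hence converge because the target is complete.
  have hex : ∀ f : p.closedSpan x, ∃ g, ((f : E), g) ∈ G := by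
    rintro ⟨f, hf⟩
    have hstep : ∀ k : ℕ, ∃ s ∈ Submodule.span 𝕜 (Set.range fun n => (x n, y n)),
        p (f - s.1) < 1 / ((k : ℝ) + 1) := by
      intro k
      obtain ⟨g, hg, hfg⟩ := hf (1 / ((k : ℝ) + 1)) (by positivity)
      obtain ⟨a, rfl⟩ := Finsupp.mem_span_range_iff_exists_finsupp.1 hg
      refine ⟨_, Finsupp.mem_span_range_iff_exists_finsupp.2 ⟨a, rfl⟩, ?_⟩
      simpa [Finsupp.sum, Prod.fst_sum] using hfg
    choose s hs hfs using hstep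
    obtain ⟨g, hg⟩ := hq (fun k => (s k).2) (by
      intro ε hε
      obtain ⟨k, hk⟩ := exists_nat_one_div_lt (show 0 < ε / (C * κ * 2) by positivity)
      refine ⟨k, fun m hm n hn => ?_⟩
      have h2 := (hspan _ (Submodule.sub_mem _ (hs m) (hs n))).1
      have h3 := hpκ.sub_le (s m).1 f (s n).1
      have h4 := hfs m
      have h5 := hfs n
      rw [p.map_sub_comm (s m).1 f] at h3
      have h6 := Nat.one_div_le_one_div (α := ℝ) hm
      have h7 := Nat.one_div_le_one_div (α := ℝ) hn
      calc q ((s m).2 - (s n).2) ≤ C * (κ * (p (f - (s m).1) + p (f - (s n).1))) :=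
            h2.trans (mul_le_mul_of_nonneg_left h3 hC.le)
        _ < C * (κ * (ε / (C * κ * 2) + ε / (C * κ * 2))) := by
            refine mul_lt_mul_of_pos_left (mul_lt_mul_of_pos_left ?_ h0) hC
            linarith
        _ = ε := by field_simp; ring)
    refine ⟨g, fun ε hε => ?_⟩
    obtain ⟨k, hk⟩ := exists_nat_one_div_lt (show 0 < ε / 2 by positivity)
    obtain ⟨m, hm⟩ := eventually_atTop.1 ((tendsto_order.1 hg).2 (ε / 2) (by positivity))
    have h2 := hm (max m k) (le_max_left _ _)
    have h3 := hfs (max m k)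
    have h4 := Nat.one_div_le_one_div (α := ℝ) (le_max_right m k)
    refine ⟨s (max m k), hs _, ?_⟩
    change p (f - _) + q (g - _) < ε
    rw [q.map_sub_comm g]
    linarith
  choose T hT using hex
  -- The graph is single-valued, which also yields linearity of `T` from linearity of `G`.
  have huniq : ∀ f g g', (f, g) ∈ G → (f, g') ∈ G → g = g' := by
    intro f g g' hg hg'
    have h2 := (hG _ (G.sub_mem hg hg')).1
    simp only [Prod.mk_sub_mk, sub_self, p.map_zero, mul_zero] at h2
    exact sub_eq_zero.1 (q.eq_zero_of_map_le_zero h2)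
  refine ⟨{ toFun := T, map_add' := ?_, map_smul' := ?_ }, ?_, ?_⟩
  · intro f g
    exact huniq _ _ _ (hT (f + g)) (G.add_mem (hT f) (hT g))
  · intro c f
    exact huniq _ _ _ (hT (c • f)) (G.smul_mem c (hT f))
  · intro n
    exact huniq _ _ _ (hT _) ((p.prod q).mem_closedSpan (fun n => (x n, y n)) n)
  · intro f
    exact hG _ (hT f)

theorem AreEquivalentWith.sum_le {p : QuasiNorm 𝕜 E} {q : QuasiNorm 𝕜 F} {x : N → E}
    {y : N → F} {C : ℝ} (h : AreEquivalentWith p q x y C) (S : Finset N) (a : N → 𝕜) :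
    q (∑ n ∈ S, a n • y n) ≤ C * p (∑ n ∈ S, a n • x n) ∧
      p (∑ n ∈ S, a n • x n) ≤ C * q (∑ n ∈ S, a n • y n) := by
  obtain ⟨T, hT, hb⟩ := h
  have h1 := hb (∑ n ∈ S, a n • ⟨x n, p.mem_closedSpan x n⟩)
  simpa only [map_sum, map_smul, hT, Submodule.coe_sum, Submodule.coe_smul] using h1

end Equivalence

/-! ### Projecting functionals. -/

section Projecting

/-- The bounded map `P` fixes the span of `y`, hence its closure, so `f = ∑ y' m (f) y m` there.
Applying `y' m` to any other expansion shows that it has the same coefficients. -/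
theorem IsProjecting.isUnconditionalBasicSequence {q : QuasiNorm 𝕜 E} {y : M → E}
    {y' : M → E →ₗ[𝕜] 𝕜} (h : q.IsProjecting y y') : q.IsUnconditionalBasicSequence y := by
  obtain ⟨κ, h1, hκ⟩ := q.add_le'
  have h0 : 0 < κ := by linarith
  obtain ⟨P, ⟨B, hB⟩, hP⟩ := h.projection
  have hPy : ∀ m, P (y m) = y m := fun m => by
    refine (hP (y m)).unique ?_
    have h2 := hasUncondSum_sum q (v := fun k => y' k (y m) • y k) (A := {m})
      (fun k hk => by rw [h.apply_ne k m (by simpa using hk), zero_smul])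
    simpa [h.apply_self] using h2
  have hPs : ∀ g ∈ Submodule.span 𝕜 (Set.range y), P g = g := fun g hg => by
    have : Submodule.span 𝕜 (Set.range y) ≤ LinearMap.eqLocus P LinearMap.id :=
      Submodule.span_le.2 (by rintro _ ⟨m, rfl⟩; exact hPy m)
    exact this hg
  intro f hf
  have hPf : P f = f := by
    rw [← sub_eq_zero]
    apply q.eq_zero_of_map_le_zero
    apply le_of_forall_pos_le_add_mul (D := κ * (|B| + 1))
    intro ε hε
    obtain ⟨g, hg, hfg⟩ := hf ε hε
    have h2 := ModulusLE.sub_le hκ (P f) g f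
    have h3 : q (P f - g) ≤ |B| * q (f - g) := by
      rw [← hPs g hg, ← map_sub, hPs g hg]
      exact (hB _).trans (mul_le_mul_of_nonneg_right (le_abs_self B) (q.nonneg' _))
    rw [q.map_sub_comm g] at h2
    calc q (P f - f) ≤ κ * (|B| * q (f - g) + q (f - g)) :=
          h2.trans (mul_le_mul_of_nonneg_left (by linarith) h0.le)
      _ = κ * (|B| + 1) * q (f - g) := by ring
      _ ≤ κ * (|B| + 1) * ε := mul_le_mul_of_nonneg_left hfg.le (by positivity)
      _ = _ := by ring
  refine ⟨fun m => y' m f, by simpa [hPf] using hP f, fun a ha => ?_⟩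
  funext m
  obtain ⟨B', hB'⟩ := h.bounded m
  have h2 := HasUncondSum.functional_eq ha hB' m (fun n hn => by
    simp [h.apply_ne m n hn.symm])
  simpa [h.apply_self] using h2.symm

/-- Small tails and completeness make the series converge; uniform bounds on finite partial sums
bound the resulting operator and all its restrictions to subsets of `M`. -/
theorem isProjecting_of_finite {q : QuasiNorm 𝕜 E} (hq : q.IsComplete) {κ C : ℝ}
    (hκ : q.ModulusLE κ) (h0 : 0 ≤ κ) {y : M → E} {y' : M → E →ₗ[𝕜] 𝕜}
    (hb : ∀ m, ∃ B : ℝ, ∀ f, ‖y' m f‖ ≤ B * q f)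
    (hs : ∀ m, y' m (y m) = 1) (hn : ∀ m n, m ≠ n → y' m (y n) = 0)
    (hC : ∀ (S : Finset M) f, q (∑ m ∈ S, y' m f • y m) ≤ C * q f)
    (ht : ∀ f, ∀ ε > 0, ∃ A : Finset M, ∀ S, Disjoint A S → q (∑ m ∈ S, y' m f • y m) < ε) :
    q.IsProjecting y y' ∧ κ * |C| ∈ upperBounds (q.gammaSet y y') := by
  classical
  refine ⟨⟨hb, hs, hn, ?_⟩, ?_⟩
  · choose P hP using fun f => hq.exists_hasUncondSum (ht f)
    refine ⟨{ toFun := P, map_add' := fun f g => ?_, map_smul' := fun c f => ?_ },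
      ⟨κ * C, fun f => ?_⟩, hP⟩
    · refine (hP (f + g)).unique ?_
      simpa [add_smul] using (hP f).add (hP g)
    · refine (hP (c • f)).unique ?_
      simpa [mul_smul] using (hP f).smul c
    · rw [mul_assoc]
      exact (hP f).le_of_forall_le hκ h0 fun A => hC A f
  · rintro _ ⟨S, f, g, hf, hg, rfl⟩
    refine hg.le_of_forall_le hκ h0 fun A => ?_
    have h2 := hC (A.map (Function.Embedding.subtype _)) f
    rw [Finset.sum_map] at h2
    refine h2.trans ?_
    calc C * q f ≤ |C| * q f := mul_le_mul_of_nonneg_right (le_abs_self C) (q.nonneg' _)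
      _ ≤ |C| * 1 := mul_le_mul_of_nonneg_left hf (abs_nonneg C)
      _ = _ := mul_one _

/-- Homogeneity: `gammaSet` tests only the unit ball, so `f` is divided by `q f`. -/
theorem sum_le_of_mem_upperBounds {q : QuasiNorm 𝕜 E} {y : M → E} {y' : M → E →ₗ[𝕜] 𝕜} {C : ℝ}
    (h : C ∈ upperBounds (q.gammaSet y y')) (S : Finset M) (f : E) :
    q (∑ m ∈ S, y' m f • y m) ≤ C * q f := by
  classical
  rcases eq_or_ne f 0 with rfl | hf
  · simp [q.map_zero]
  have h0 := q.pos' f hf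
  have h1 : q (∑ m ∈ S, y' m ((((q f)⁻¹ : ℝ) : 𝕜) • f) • y m) ≤ C := by
    refine h ⟨(S : Set M), (((q f)⁻¹ : ℝ) : 𝕜) • f, _, ?_, ?_, rfl⟩
    · rw [q.smul', RCLike.norm_ofReal, abs_of_pos (inv_pos.2 h0), inv_mul_cancel₀ h0.ne']
    · have h2 := hasUncondSum_sum q (N := S) (A := Finset.univ)
        (v := fun m : S => y' m ((((q f)⁻¹ : ℝ) : 𝕜) • f) • y m) (by simp)
      rwa [Finset.sum_coe_sort S (fun m => y' m ((((q f)⁻¹ : ℝ) : 𝕜) • f) • y m)] at h2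
  simp only [map_smul, smul_assoc] at h1
  rw [← Finset.smul_sum, q.smul', RCLike.norm_ofReal, abs_of_pos (inv_pos.2 h0),
    inv_mul_le_iff₀ h0] at h1
  linarith

end Projecting

end QuasiNorm
end QuasiBanach
end

noncomputable section
namespace QuasiBanach

namespace QuasiNorm

theorem HasUncondSum.comp_injective_iff {𝕜 E N M : Type*} [RCLike 𝕜] [AddCommGroup E]
    [Module 𝕜 E] {q : QuasiNorm 𝕜 E} {v : N → E} {f : E} {g : M → N}
    (hg : Function.Injective g) (hv : ∀ n ∉ Set.range g, v n = 0) :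
    q.HasUncondSum (fun m => v (g m)) f ↔ q.HasUncondSum v f := by
  have h := hg.map_atTop_finsetSum_eq hv
  unfold HasUncondSum
  change Tendsto ((fun e => q (e - f)) ∘ _) _ _ ↔ Tendsto ((fun e => q (e - f)) ∘ _) _ _
  rw [← tendsto_map'_iff, ← tendsto_map'_iff, h]

theorem coeff_neg {𝕜 E N : Type*} [RCLike 𝕜] [AddCommGroup E] [Module 𝕜 E] {q : QuasiNorm 𝕜 E}
    {x : N → E} (hx : q.IsUnconditionalBasis x) (f : E) : q.coeff x (-f) = -q.coeff x f := by
  simpa using coeff_smul hx (-1) f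

end QuasiNorm

open QuasiNorm

/-! ### Coordinates in a sequence space. -/

section SequenceSpace

variable {𝕜 J : Type*} [RCLike 𝕜] (L : SequenceSpace 𝕜 J)

theorem SequenceSpace.unitVector_self (j : J) : (L.unitVector j : J → 𝕜) j = 1 := by
  simp [SequenceSpace.unitVector]

theorem SequenceSpace.unitVector_ne {j k : J} (h : k ≠ j) :
    (L.unitVector j : J → 𝕜) k = 0 := by
  simp [SequenceSpace.unitVector, h]

theorem SequenceSpace.qnorm_unitVector (j : J) : L.qnorm (L.unitVector j) = 1 := by
  rw [← L.qnorm_single j]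
  congr!

theorem SequenceSpace.norm_apply_le (a : L.carrier) (j : J) :
    ‖(a : J → 𝕜) j‖ ≤ L.qnorm a := by
  have h : L.qnorm ((a : J → 𝕜) j • L.unitVector j) ≤ L.qnorm a := by
    apply L.qnorm_le
    intro k
    by_cases hk : k = j
    · subst hk
      simp [L.unitVector_self]
    · simp [L.unitVector_ne hk]
  rwa [L.qnorm.smul', L.qnorm_unitVector, mul_one] at h

/-- The coordinate functionals of a sequence space. -/
def SequenceSpace.coord (j : J) : L.carrier →ₗ[𝕜] 𝕜 :=
  (LinearMap.proj j).comp L.carrier.subtype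

theorem SequenceSpace.apply_eq_of_hasUncondSum {a : J → 𝕜} {b : L.carrier}
    (h : L.qnorm.HasUncondSum (fun j => a j • L.unitVector j) b) (j : J) :
    (b : J → 𝕜) j = a j := by
  have h1 := HasUncondSum.functional_eq h (φ := L.coord j) (B := 1)
    (fun g => by rw [one_mul]; exact L.norm_apply_le g j) j (fun n hn => by
      simp [SequenceSpace.coord, L.unitVector_ne hn.symm])
  simpa [SequenceSpace.coord, L.unitVector_self] using h1

theorem SequenceSpace.coeff_unitVector (hL : L.qnorm.IsUnconditionalBasis L.unitVector)
    (b : L.carrier) : L.qnorm.coeff L.unitVector b = b := by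
  funext j
  exact (L.apply_eq_of_hasUncondSum (hasUncondSum_coeff hL b) j).symm

end SequenceSpace

/-! ### Quasi-norm and completeness of the direct sum. -/

section DirectSum

variable {𝕜 J : Type*} [RCLike 𝕜] {X : J → Type*} [∀ j, AddCommGroup (X j)]
  [∀ j, Module 𝕜 (X j)] {L : SequenceSpace 𝕜 J} {q : ∀ j, QuasiNorm 𝕜 (X j)} {κ : ℝ}
  {hκ : ∀ j, (q j).ModulusLE κ}

/-- The vector `(‖f j‖)ⱼ` of the sequence space. -/
def normVec (f : directSum L q κ hκ) : L.carrier := ⟨normFamily q f, f.2⟩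

theorem norm_normVec (f : directSum L q κ hκ) (j : J) :
    ‖(normVec f : J → 𝕜) j‖ = q j ((f : ∀ j, X j) j) := norm_normFamily q f j

theorem directSumNorm_le_qnorm (f : directSum L q κ hκ) (a : L.carrier)
    (h : ∀ j, q j ((f : ∀ j, X j) j) ≤ ‖(a : J → 𝕜) j‖) :
    directSumNorm L q κ hκ f ≤ L.qnorm a := by
  refine L.qnorm_le _ _ fun j => ?_
  rw [norm_normFamily]
  exact h j

theorem directSumNorm_le_mul (f g : directSum L q κ hκ) {D : ℝ} (hD : 0 ≤ D)
    (h : ∀ j, q j ((f : ∀ j, X j) j) ≤ D * q j ((g : ∀ j, X j) j)) :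
    directSumNorm L q κ hκ f ≤ D * directSumNorm L q κ hκ g := by
  have h1 := directSumNorm_le_qnorm f ((D : 𝕜) • normVec g) (fun j => by
    rw [Submodule.coe_smul, Pi.smul_apply, norm_smul, norm_normVec, RCLike.norm_ofReal,
      abs_of_nonneg hD]
    exact h j)
  rwa [L.qnorm.smul', RCLike.norm_ofReal, abs_of_nonneg hD] at h1

theorem apply_le_directSumNorm (f : directSum L q κ hκ) (j : J) :
    q j ((f : ∀ j, X j) j) ≤ directSumNorm L q κ hκ f := by
  have h := L.norm_apply_le (normVec f) j
  rwa [norm_normVec] at h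

theorem directSumIncl_self (j : J) (v : X j) :
    (directSumIncl L q κ hκ j v : ∀ j, X j) j = v := by
  simp [directSumIncl]

theorem directSumIncl_ne {j k : J} (h : k ≠ j) (v : X j) :
    (directSumIncl L q κ hκ j v : ∀ j, X j) k = 0 := by
  simp [directSumIncl, h]

theorem directSumNorm_incl (j : J) (v : X j) :
    directSumNorm L q κ hκ (directSumIncl L q κ hκ j v) = q j v := by
  apply le_antisymm
  · have h := directSumNorm_le_qnorm (directSumIncl L q κ hκ j v)
      (((q j v : ℝ) : 𝕜) • L.unitVector j) (fun k => by
        by_cases hk : k = j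
        · subst hk
          simp [directSumIncl_self, L.unitVector_self, le_abs_self]
        · simp [directSumIncl_ne hk, L.unitVector_ne hk, QuasiNorm.map_zero])
    rwa [L.qnorm.smul', L.qnorm_unitVector, mul_one, RCLike.norm_ofReal,
      abs_of_nonneg ((q j).nonneg' v)] at h
  · have h := apply_le_directSumNorm (directSumIncl L q κ hκ j v) j
    rwa [directSumIncl_self] at h

/-- Evaluation of the members of a direct sum at an index. -/
def directSumEval (L : SequenceSpace 𝕜 J) (q : ∀ j, QuasiNorm 𝕜 (X j)) (κ : ℝ)
    (hκ : ∀ j, (q j).ModulusLE κ) (j : J) : directSum L q κ hκ →ₗ[𝕜] X j :=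
  (LinearMap.proj j).comp (directSum L q κ hκ).subtype

theorem directSum_sum_apply {M : Type*} (S : Finset M) (w : M → directSum L q κ hκ) (j : J) :
    ((∑ m ∈ S, w m : directSum L q κ hκ) : ∀ j, X j) j = ∑ m ∈ S, (w m : ∀ j, X j) j :=
  map_sum (directSumEval L q κ hκ j) w S

/-- The canonical embedding of a summand, as a linear map. -/
def directSumInclMap (L : SequenceSpace 𝕜 J) (q : ∀ j, QuasiNorm 𝕜 (X j)) (κ : ℝ)
    (hκ : ∀ j, (q j).ModulusLE κ) (j : J) : X j →ₗ[𝕜] directSum L q κ hκ where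
  toFun := directSumIncl L q κ hκ j
  map_add' f g := by
    apply Subtype.ext
    simp [directSumIncl, Pi.single_add]
  map_smul' c f := by
    apply Subtype.ext
    simp [directSumIncl, Pi.single_smul]

theorem sum_incl_apply_of_mem {S : Finset J} (v : ∀ j, X j) {j : J} (hj : j ∈ S) :
    ((∑ k ∈ S, directSumIncl L q κ hκ k (v k) : directSum L q κ hκ) : ∀ j, X j) j = v j := by
  rw [directSum_sum_apply, Finset.sum_eq_single_of_mem j hj fun k _ hk => ?_, directSumIncl_self]
  exact directSumIncl_ne hk.symm _

theorem sum_incl_apply_of_notMem {S : Finset J} (v : ∀ j, X j) {j : J} (hj : j ∉ S) :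
    ((∑ k ∈ S, directSumIncl L q κ hκ k (v k) : directSum L q κ hκ) : ∀ j, X j) j = 0 := by
  rw [directSum_sum_apply]
  exact Finset.sum_eq_zero fun k hk => directSumIncl_ne (by rintro rfl; exact hj hk) _

/-- Turns smallness in each of finitely many coordinates into smallness in quasi-norm. -/
theorem directSumNorm_sum_incl_le (S : Finset J) (v : ∀ j, X j) {δ : ℝ} (hδ : 0 ≤ δ)
    (h : ∀ j ∈ S, q j (v j) ≤ δ) :
    directSumNorm L q κ hκ (∑ j ∈ S, directSumIncl L q κ hκ j (v j)) ≤
      δ * L.qnorm (∑ j ∈ S, L.unitVector j) := by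
  have h1 := directSumNorm_le_qnorm (∑ j ∈ S, directSumIncl L q κ hκ j (v j))
    ((δ : 𝕜) • ∑ j ∈ S, L.unitVector j) (fun j => by
      by_cases hj : j ∈ S
      · rw [sum_incl_apply_of_mem v hj]
        have h2 : ((∑ k ∈ S, L.unitVector k : L.carrier) : J → 𝕜) j = 1 := by
          rw [Submodule.coe_sum, Finset.sum_apply, Finset.sum_eq_single_of_mem j hj fun k _ hk => ?_,
            L.unitVector_self]
          exact L.unitVector_ne hk.symm
        rw [Submodule.coe_smul, Pi.smul_apply, h2, norm_smul, norm_one, mul_one,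
          RCLike.norm_ofReal, abs_of_nonneg hδ]
        exact h j hj
      · rw [sum_incl_apply_of_notMem v hj, QuasiNorm.map_zero]
        exact norm_nonneg _)
  rwa [L.qnorm.smul', RCLike.norm_ofReal, abs_of_nonneg hδ] at h1

theorem qnorm_sum_le_directSumNorm (S : Finset J) (v : ∀ j, X j) :
    L.qnorm (∑ j ∈ S, normFamily q v j • L.unitVector j) ≤
      directSumNorm L q κ hκ (∑ j ∈ S, directSumIncl L q κ hκ j (v j)) := by
  refine L.qnorm_le _ _ fun j => ?_
  rw [norm_normFamily]
  rw [Submodule.coe_sum, Finset.sum_apply]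
  by_cases hj : j ∈ S
  · rw [sum_incl_apply_of_mem v hj, Finset.sum_eq_single_of_mem j hj fun k _ hk => ?_]
    · simp [L.unitVector_self, norm_normFamily]
    · simp [L.unitVector_ne hk.symm]
  · rw [Finset.sum_eq_zero fun k hk => ?_, norm_zero]
    · exact nonneg' _ _
    · have : j ≠ k := fun h => hj (h ▸ hk)
      simp [L.unitVector_ne this]

/-- The coordinate quasi-norms of `f` minus a partial sum are exactly the remainder of `(‖f j‖)ⱼ` in
its unit vector expansion, which tends to zero in `L`. -/
theorem hasUncondSum_incl (hL : L.qnorm.IsUnconditionalBasis L.unitVector)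
    (f : directSum L q κ hκ) :
    (directSumNorm L q κ hκ).HasUncondSum
      (fun j => directSumIncl L q κ hκ j ((f : ∀ j, X j) j)) f := by
  have h := hasUncondSum_coeff hL (normVec f)
  rw [L.coeff_unitVector hL] at h
  refine squeeze_zero (fun _ => nonneg' _ _) (fun S => ?_) h
  refine directSumNorm_le_qnorm _ _ fun j => ?_
  rw [Submodule.coe_sub, Pi.sub_apply, Submodule.coe_sub, Pi.sub_apply]
  by_cases hj : j ∈ S
  · rw [sum_incl_apply_of_mem _ hj, sub_self, QuasiNorm.map_zero]
    exact norm_nonneg _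
  · rw [sum_incl_apply_of_notMem _ hj, zero_sub, QuasiNorm.map_neg, Submodule.coe_sum,
      Finset.sum_apply, Finset.sum_eq_zero fun k hk => ?_, zero_sub, norm_neg, norm_normVec]
    have : j ≠ k := fun h => hj (h ▸ hk)
    simp [L.unitVector_ne this]

theorem directSumIncl_sub_add_sub (j : J) (f g h : X j) :
    directSumIncl L q κ hκ j (f - h) =
      directSumIncl L q κ hκ j (f - g) + directSumIncl L q κ hκ j (g - h) := by
  have := (directSumInclMap L q κ hκ j).map_add (f - g) (g - h)
  rwa [sub_add_sub_cancel] at this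

/-- Coordinatewise limits inherit bounds uniformly over finite sets `S`: although the term `u m`
compared with `f` depends on `S`, the final bound does not. -/
theorem directSumNorm_sum_incl_limit_le {κ' ε : ℝ}
    (hκ' : (directSumNorm L q κ hκ).ModulusLE κ') (h0 : 0 ≤ κ') {u : ℕ → directSum L q κ hκ}
    {f : ∀ j, X j} (hf : ∀ j, Tendsto (fun n => q j ((u n : ∀ j, X j) j - f j)) atTop (𝓝 0))
    (hε : 0 < ε) {g : directSum L q κ hκ} {n₀ : ℕ}
    (hn₀ : ∀ m ≥ n₀, directSumNorm L q κ hκ (u m - g) ≤ ε) (S : Finset J) :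
    directSumNorm L q κ hκ
      (∑ j ∈ S, directSumIncl L q κ hκ j (f j - (g : ∀ j, X j) j)) ≤ κ' * (ε + ε) := by
  have hs : 0 ≤ L.qnorm (∑ j ∈ S, L.unitVector j) := nonneg' _ _
  let δ := ε / (L.qnorm (∑ j ∈ S, L.unitVector j) + 1)
  have hδ : 0 < δ := by positivity
  have hev : ∀ᶠ m in atTop, n₀ ≤ m ∧ ∀ j ∈ S, q j ((u m : ∀ j, X j) j - f j) < δ :=
    (eventually_ge_atTop n₀).and ((Finset.eventually_all S).2
      fun j _ => (tendsto_order.1 (hf j)).2 δ hδ)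
  obtain ⟨m, hm, hmS⟩ := hev.exists
  have e : ∑ j ∈ S, directSumIncl L q κ hκ j (f j - (g : ∀ j, X j) j) =
      ∑ j ∈ S, directSumIncl L q κ hκ j (f j - (u m : ∀ j, X j) j) +
      ∑ j ∈ S, directSumIncl L q κ hκ j ((u m : ∀ j, X j) j - (g : ∀ j, X j) j) := by
    rw [← Finset.sum_add_distrib]
    exact Finset.sum_congr rfl fun j _ => directSumIncl_sub_add_sub j _ _ _
  rw [e]
  refine (hκ' _ _).trans (mul_le_mul_of_nonneg_left (add_le_add ?_ ?_) h0)
  · refine (directSumNorm_sum_incl_le S _ hδ.le fun j hj => ?_).trans ?_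
    · rw [map_sub_comm]
      exact (hmS j hj).le
    · calc _ ≤ δ * (L.qnorm (∑ j ∈ S, L.unitVector j) + 1) :=
            mul_le_mul_of_nonneg_left (by linarith) hδ.le
        _ = ε := div_mul_cancel₀ _ (by positivity)
  · refine le_trans ?_ (hn₀ m hm)
    rw [← one_mul (directSumNorm L q κ hκ (u m - g))]
    refine directSumNorm_le_mul _ _ zero_le_one fun j => ?_
    rw [one_mul]
    by_cases hj : j ∈ S
    · rw [sum_incl_apply_of_mem (fun j => (u m : ∀ j, X j) j - (g : ∀ j, X j) j) hj]
      rfl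
    · rw [sum_incl_apply_of_notMem (fun j => (u m : ∀ j, X j) j - (g : ∀ j, X j) j) hj,
        QuasiNorm.map_zero]
      exact nonneg' _ _

/-- `L` need not have the Fatou property, so bounded finite truncations would not place `(‖f j‖)ⱼ`
in `L`. Instead the series `∑ ‖f j‖ e_j` is shown to have small tails: those of `u n` are small, and
`f - u n` is small on all finite sets. -/
theorem mem_directSum_of_approx (hL : L.qnorm.IsUnconditionalBasis L.unitVector)
    {κ' : ℝ} (hκ' : (directSumNorm L q κ hκ).ModulusLE κ') (h0 : 0 < κ')
    {u : ℕ → directSum L q κ hκ} {f : ∀ j, X j}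
    (hpart : ∀ ε > 0, ∃ n₀, ∀ n ≥ n₀, ∀ S : Finset J, directSumNorm L q κ hκ
      (∑ j ∈ S, directSumIncl L q κ hκ j (f j - (u n : ∀ j, X j) j)) ≤ ε) :
    f ∈ directSum L q κ hκ := by
  obtain ⟨a, ha⟩ := L.complete.exists_hasUncondSum
      (v := fun j => normFamily q f j • L.unitVector j) (by
    intro ε hε
    have hε' : 0 < ε / (κ' * 2) := by positivity
    obtain ⟨n, hn⟩ := hpart _ hε'
    obtain ⟨A, hA⟩ := (hasUncondSum_incl hL (u n)).exists_tail hε'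
    refine ⟨A, fun B hB => (qnorm_sum_le_directSumNorm (κ := κ) (hκ := hκ) B f).trans_lt ?_⟩
    have e : ∑ j ∈ B, directSumIncl L q κ hκ j (f j) =
        ∑ j ∈ B, directSumIncl L q κ hκ j (f j - (u n : ∀ j, X j) j) +
        ∑ j ∈ B, directSumIncl L q κ hκ j ((u n : ∀ j, X j) j) := by
      rw [← Finset.sum_add_distrib]
      refine Finset.sum_congr rfl fun j _ => ?_
      simpa using directSumIncl_sub_add_sub (L := L) (hκ := hκ) j (f j) ((u n : ∀ j, X j) j) 0
    rw [e]
    calc _ ≤ κ' * _ := hκ' _ _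
      _ < κ' * (ε / (κ' * 2) + ε / (κ' * 2)) :=
        mul_lt_mul_of_pos_left (add_lt_add_of_le_of_lt (hn n le_rfl B) (hA B hB)) h0
      _ = ε := by field_simp; ring)
  have h2 : (a : J → 𝕜) = normFamily q f := funext fun j => L.apply_eq_of_hasUncondSum ha j
  have h3 : normFamily q f ∈ L.carrier := h2 ▸ a.2
  exact h3

theorem directSumNorm_isComplete (hL : L.qnorm.IsUnconditionalBasis L.unitVector)
    (hq : ∀ j, (q j).IsComplete) : (directSumNorm L q κ hκ).IsComplete := by
  intro u hu
  obtain ⟨κ', h1, hκ'⟩ := (directSumNorm L q κ hκ).add_le'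
  have h0 : 0 < κ' := by linarith
  have hlim : ∀ j, ∃ f, Tendsto (fun n => q j ((u n : ∀ j, X j) j - f)) atTop (𝓝 0) := by
    intro j
    refine hq j _ fun ε hε => ?_
    obtain ⟨n₀, hn₀⟩ := hu ε hε
    exact ⟨n₀, fun m hm n hn => (apply_le_directSumNorm (u m - u n) j).trans_lt (hn₀ m hm n hn)⟩
  choose f hf using hlim
  have hpart : ∀ ε > 0, ∃ n₀, ∀ n ≥ n₀, ∀ S : Finset J, directSumNorm L q κ hκ
      (∑ j ∈ S, directSumIncl L q κ hκ j (f j - (u n : ∀ j, X j) j)) ≤ ε := by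
    intro ε hε
    have hε' : 0 < ε / (κ' * 2) := by positivity
    obtain ⟨n₀, hn₀⟩ := hu _ hε'
    refine ⟨n₀, fun n hn S => (directSumNorm_sum_incl_limit_le hκ' h0.le hf hε'
      (fun m hm => (hn₀ m hm n hn).le) S).trans_eq ?_⟩
    field_simp
    ring
  obtain ⟨g, rfl⟩ : ∃ g : directSum L q κ hκ, (g : ∀ j, X j) = f :=
    ⟨⟨f, mem_directSum_of_approx hL hκ' h0 hpart⟩, rfl⟩
  refine ⟨g, ?_⟩
  rw [Metric.tendsto_atTop]
  intro ε hε
  obtain ⟨n₀, hn₀⟩ := hpart (ε / (κ' * 2)) (by positivity)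
  refine ⟨n₀, fun n hn => ?_⟩
  rw [Real.dist_0_eq_abs, abs_of_nonneg (nonneg' _ _), map_sub_comm]
  refine ((hasUncondSum_incl hL (g - u n)).le_of_forall_le hκ' h0.le (hn₀ n hn)).trans_lt ?_
  calc κ' * (ε / (κ' * 2)) = ε / 2 := by field_simp
    _ < ε := by linarith

/-! ### The canonical basis of the direct sum. -/

section Basis

variable {N : J → Type*} {x : ∀ j, N j → X j}

theorem coeff_directSumBasis_apply [DecidableEq (Σ j, N j)]
    (hx : ∀ j, (q j).IsUnconditionalBasis (x j)) (i : Σ j, N j) (j : J) (n : N j) :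
    (q j).coeff (x j) ((directSumBasis L q κ hκ x i : ∀ j, X j) j) n =
      if i = ⟨j, n⟩ then 1 else 0 := by
  classical
  obtain ⟨k, m⟩ := i
  by_cases hk : j = k
  · subst hk
    simp only [directSumBasis, directSumIncl_self, coeff_basis (hx j)]
    by_cases hm : n = m
    · subst hm; simp
    · rw [if_neg (by rintro ⟨⟩; exact hm rfl), Pi.single_eq_of_ne hm]
  · have : (q j).coeff (x j) 0 = 0 := _root_.map_zero (coeffMap (hx j))
    simp only [directSumBasis, directSumIncl_ne hk, this]
    rw [if_neg (by rintro ⟨⟩; exact hk rfl)]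
    rfl

theorem hasUncondSum_directSumBasis_apply {a : (Σ j, N j) → 𝕜} {f : directSum L q κ hκ}
    (j : J) : (q j).HasUncondSum (fun i => a i • (directSumBasis L q κ hκ x i : ∀ j, X j) j)
        ((f : ∀ j, X j) j) ↔
      (q j).HasUncondSum (fun n => a ⟨j, n⟩ • x j n) ((f : ∀ j, X j) j) := by
  rw [← HasUncondSum.comp_injective_iff (g := fun n : N j => (⟨j, n⟩ : Σ j, N j))
    (sigma_mk_injective)]
  · simp [directSumBasis, directSumIncl_self]
  · rintro ⟨k, m⟩ h
    have hk : j ≠ k := by rintro rfl; exact h ⟨m, rfl⟩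
    simp [directSumBasis, directSumIncl_ne hk]

theorem coeff_eq_of_hasUncondSum_directSumBasis (hx : ∀ j, (q j).IsUnconditionalBasis (x j))
    {a : (Σ j, N j) → 𝕜} {f : directSum L q κ hκ}
    (h : (directSumNorm L q κ hκ).HasUncondSum (fun i => a i • directSumBasis L q κ hκ x i) f)
    (i : Σ j, N j) : a i = (q i.1).coeff (x i.1) ((f : ∀ j, X j) i.1) i.2 := by
  have h1 := h.map (directSumEval L q κ hκ i.1) (q := q i.1) (B := 1)
    (fun g => by rw [one_mul]; exact apply_le_directSumNorm g i.1)
  rw [coeff_eq (hx i.1) ((hasUncondSum_directSumBasis_apply (a := a) i.1).1 h1)]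

/-- A finite set `S` of summands carries `f` up to `ε'`. On `S` the expansions in the single
summands are used up to `δ`; off `S` the lattice property controls the error by the tail of `f`,
whatever the partial sum. -/
theorem hasUncondSum_directSumBasis (hL : L.qnorm.IsUnconditionalBasis L.unitVector)
    (hx : ∀ j, (q j).IsUnconditionalBasis (x j)) {D : ℝ} (hD : 0 ≤ D)
    (hlat : ∀ j, (q j).IsLatticeWith (x j) D) (f : directSum L q κ hκ) {c : (Σ j, N j) → 𝕜}
    (hc : ∀ i, c i = (q i.1).coeff (x i.1) ((f : ∀ j, X j) i.1) i.2) :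
    (directSumNorm L q κ hκ).HasUncondSum (fun i => c i • directSumBasis L q κ hκ x i) f := by
  classical
  obtain ⟨κ', h1, hκ'⟩ := (directSumNorm L q κ hκ).add_le'
  have h0 : 0 < κ' := by linarith
  refine hasUncondSum_iff.2 fun ε hε => ?_
  let ε' := ε / (κ' * (1 + D) * 2)
  have hε' : 0 < ε' := by positivity
  obtain ⟨S, hS⟩ := hasUncondSum_iff.1 (hasUncondSum_incl hL f) ε' hε'
  replace hS := hS S subset_rfl
  have hs : 0 ≤ L.qnorm (∑ j ∈ S, L.unitVector j) := nonneg' _ _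
  let δ := ε' / (L.qnorm (∑ j ∈ S, L.unitVector j) + 1)
  have hδ : 0 < δ := by positivity
  have hex : ∀ j, ∃ A₀ : Finset (Σ j, N j), ∀ A, A₀ ⊆ A → q j (∑ i ∈ A,
      c i • (directSumBasis L q κ hκ x i : ∀ j, X j) j - (f : ∀ j, X j) j) < δ := fun j => by
    refine hasUncondSum_iff.1 ((hasUncondSum_directSumBasis_apply (a := c) j).2 ?_) δ hδ
    simp only [hc]
    exact hasUncondSum_coeff (hx j) _
  choose A₀ hA₀ using hex
  refine ⟨S.biUnion A₀, fun A hA => ?_⟩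
  have hgj : ∀ j, ((∑ i ∈ A, c i • directSumBasis L q κ hκ x i - f : directSum L q κ hκ) :
      ∀ j, X j) j =
      ∑ i ∈ A, c i • (directSumBasis L q κ hκ x i : ∀ j, X j) j - (f : ∀ j, X j) j := fun j => by
    rw [Submodule.coe_sub, Pi.sub_apply, directSum_sum_apply]
    rfl
  generalize ∑ i ∈ A, c i • directSumBasis L q κ hκ x i - f = g at hgj ⊢
  -- Each coefficient of `g` is either zero or the negative of that of `f`.
  have hgD : ∀ j, q j ((g : ∀ j, X j) j) ≤ D * q j ((f : ∀ j, X j) j) := by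
    intro j
    refine hlat j _ _ fun n => ?_
    rw [hgj, sub_eq_add_neg, coeff_add (hx j), coeff_neg (hx j), Pi.add_apply, coeff_sum (hx j)]
    simp only [coeff_smul (hx j), Pi.smul_apply, coeff_directSumBasis_apply hx, smul_eq_mul,
      mul_ite, mul_one, mul_zero, Finset.sum_ite_eq', hc]
    split_ifs <;> simp
  have e : g = (g - ∑ j ∈ S, directSumIncl L q κ hκ j ((g : ∀ j, X j) j)) +
      ∑ j ∈ S, directSumIncl L q κ hκ j ((g : ∀ j, X j) j) := by abel
  rw [e]
  refine (hκ' _ _).trans_lt ?_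
  have h2 : directSumNorm L q κ hκ (∑ j ∈ S, directSumIncl L q κ hκ j ((g : ∀ j, X j) j)) ≤ ε' := by
    refine (directSumNorm_sum_incl_le S _ hδ.le fun j hj => ?_).trans ?_
    · rw [hgj]
      exact (hA₀ j A ((Finset.subset_biUnion_of_mem A₀ hj).trans hA)).le
    · calc _ ≤ δ * (L.qnorm (∑ j ∈ S, L.unitVector j) + 1) :=
            mul_le_mul_of_nonneg_left (by linarith) hδ.le
        _ = ε' := div_mul_cancel₀ _ (by positivity)
  have h3 : directSumNorm L q κ hκ (g - ∑ j ∈ S, directSumIncl L q κ hκ j ((g : ∀ j, X j) j)) ≤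
      D * ε' := by
    refine (directSumNorm_le_mul _ _ hD fun j => ?_).trans (mul_le_mul_of_nonneg_left hS.le hD)
    rw [Submodule.coe_sub, Pi.sub_apply, Submodule.coe_sub, Pi.sub_apply]
    by_cases hj : j ∈ S
    · rw [sum_incl_apply_of_mem _ hj, sum_incl_apply_of_mem _ hj]
      simp [QuasiNorm.map_zero]
    · rw [sum_incl_apply_of_notMem _ hj, sum_incl_apply_of_notMem _ hj, sub_zero, zero_sub,
        QuasiNorm.map_neg]
      exact hgD j
  calc _ ≤ κ' * (D * ε' + ε') := mul_le_mul_of_nonneg_left (add_le_add h3 h2) h0.le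
    _ = ε / 2 := by simp only [ε']; field_simp; ring
    _ < ε := by linarith

theorem directSumBasis_isUnconditionalBasis (hL : L.qnorm.IsUnconditionalBasis L.unitVector)
    (hx : ∀ j, (q j).IsUnconditionalBasis (x j)) {D : ℝ} (hD : 0 ≤ D)
    (hlat : ∀ j, (q j).IsLatticeWith (x j) D) :
    (directSumNorm L q κ hκ).IsUnconditionalBasis (directSumBasis L q κ hκ x) := by
  refine ⟨fun f _ => ⟨_, hasUncondSum_directSumBasis hL hx hD hlat f fun _ => rfl, fun a ha =>
    funext fun i => coeff_eq_of_hasUncondSum_directSumBasis hx ha i⟩, ?_⟩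
  refine eq_top_iff.2 fun f _ ε hε => ?_
  obtain ⟨A, hA⟩ := hasUncondSum_iff.1 (hasUncondSum_directSumBasis hL hx hD hlat f fun _ => rfl) ε hε
  refine ⟨_, Submodule.sum_mem _ fun i _ => Submodule.smul_mem _ _ (Submodule.subset_span ⟨i, rfl⟩),
    (map_sub_comm _ _ _).trans_lt (hA A subset_rfl)⟩

theorem coeff_directSumBasis (hL : L.qnorm.IsUnconditionalBasis L.unitVector)
    (hx : ∀ j, (q j).IsUnconditionalBasis (x j)) {D : ℝ} (hD : 0 ≤ D)
    (hlat : ∀ j, (q j).IsLatticeWith (x j) D) (f : directSum L q κ hκ) (i : Σ j, N j) :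
    (directSumNorm L q κ hκ).coeff (directSumBasis L q κ hκ x) f i =
      (q i.1).coeff (x i.1) ((f : ∀ j, X j) i.1) i.2 :=
  coeff_eq_of_hasUncondSum_directSumBasis hx
    (hasUncondSum_coeff (directSumBasis_isUnconditionalBasis hL hx hD hlat) f) i

theorem directSumBasis_isLatticeWith (hL : L.qnorm.IsUnconditionalBasis L.unitVector)
    (hx : ∀ j, (q j).IsUnconditionalBasis (x j)) {D : ℝ} (hD : 0 ≤ D)
    (hlat : ∀ j, (q j).IsLatticeWith (x j) D) :
    (directSumNorm L q κ hκ).IsLatticeWith (directSumBasis L q κ hκ x) D := by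
  intro f g h
  refine directSumNorm_le_mul f g hD fun j => hlat j _ _ fun n => ?_
  simpa only [coeff_directSumBasis hL hx hD hlat] using h ⟨j, n⟩

theorem directSumBasis_isNormalized (hn : ∀ j, (q j).IsNormalized (x j)) :
    (directSumNorm L q κ hκ).IsNormalized (directSumBasis L q κ hκ x) := fun i => by
  rw [directSumBasis, directSumNorm_incl]
  exact hn i.1 i.2

end Basis

end DirectSum

end QuasiBanach
end

noncomputable section
namespace QuasiBanach

/-! ### Block systems. -/

namespace QuasiNorm

section

variable {𝕜 E F N M : Type*} [RCLike 𝕜] [AddCommGroup E] [Module 𝕜 E]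
  [AddCommGroup F] [Module 𝕜 F] {q : QuasiNorm 𝕜 E} {x : N → E}

theorem HasUncondSum.functional_eq_zero {v : N → E} {f : E} (hf : q.HasUncondSum v f)
    {φ : E →ₗ[𝕜] 𝕜} {B : ℝ} (hB : ∀ g, ‖φ g‖ ≤ B * q g) (hv : ∀ n, φ (v n) = 0) : φ f = 0 := by
  have h1 := hf.map (q := scalar 𝕜) φ hB
  have h2 := hasUncondSum_sum (scalar 𝕜) (v := fun n => φ (v n)) (A := ∅) fun n _ => hv n
  rw [Finset.sum_empty] at h2
  exact h1.unique h2

theorem IsLatticeWith.mono {D D' : ℝ} (h : q.IsLatticeWith x D) (hD : D ≤ D') :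
    q.IsLatticeWith x D' := fun f g hfg =>
  (h f g hfg).trans (mul_le_mul_of_nonneg_right hD (q.nonneg' _))

theorem AreEquivalentWith.mono {p : QuasiNorm 𝕜 E} {q : QuasiNorm 𝕜 F} {x : N → E} {y : N → F}
    {C C' : ℝ} (h : AreEquivalentWith p q x y C) (hC : C ≤ C') :
    AreEquivalentWith p q x y C' := by
  obtain ⟨T, hT, hb⟩ := h
  exact ⟨T, hT, fun f => ⟨(hb f).1.trans (mul_le_mul_of_nonneg_right hC (p.nonneg' _)),
    (hb f).2.trans (mul_le_mul_of_nonneg_right hC (q.nonneg' _))⟩⟩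

theorem IsLatticeWith.sum_smul_le {D t : ℝ} (hD : q.IsLatticeWith x D)
    (hx : q.IsUnconditionalBasis x) (S : Finset M) {w : M → E} {a b : M → 𝕜} (ht : 0 ≤ t)
    (hab : ∀ m, ‖a m‖ ≤ t * ‖b m‖)
    (hd : ∀ m k n, m ≠ k → q.coeff x (w m) n ≠ 0 → q.coeff x (w k) n = 0) :
    q (∑ m ∈ S, a m • w m) ≤ D * t * q (∑ m ∈ S, b m • w m) := by
  have h := hD.sum_le hx S (w := fun m => a m • w m) (w' := fun m => ((t : 𝕜) * b m) • w m)
    (fun m n => by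
      simp only [coeff_smul hx, Pi.smul_apply, norm_smul, norm_mul, RCLike.norm_ofReal,
        abs_of_nonneg ht]
      exact mul_le_mul_of_nonneg_right (hab m) (norm_nonneg _))
    (fun m k n hmk hn => by
      simp only [coeff_smul hx, Pi.smul_apply] at hn ⊢
      rw [hd m k n hmk (right_ne_zero_of_smul hn), smul_zero])
  simp only [mul_smul, ← Finset.smul_sum] at h
  rwa [q.smul', RCLike.norm_ofReal, abs_of_nonneg ht, ← mul_assoc] at h

/-- A normalized disjointly supported sequence of blocks of `x`, with functionals supported on the
blocks whose partial sums `∑ y'ₘ(f) yₘ` are bounded by `C` and have small tails. -/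
structure IsBlockSystem (q : QuasiNorm 𝕜 E) (x : N → E) (y : M → E) (y' : M → E →ₗ[𝕜] 𝕜)
    (C : ℝ) : Prop where
  norm_eq : ∀ m, q (y m) = 1
  apply_self : ∀ m, y' m (y m) = 1
  sum_le : ∀ (S : Finset M) f, q (∑ m ∈ S, y' m f • y m) ≤ C * q f
  tail : ∀ f, ∀ ε > 0, ∃ A : Finset M, ∀ S, Disjoint A S → q (∑ m ∈ S, y' m f • y m) < ε
  coeff_ne : ∀ m n, y' m (x n) ≠ 0 → q.coeff x (y m) n ≠ 0
  finite : ∀ m, (q.supp x (y m)).Finite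
  disjoint : ∀ m k n, m ≠ k → q.coeff x (y m) n ≠ 0 → q.coeff x (y k) n = 0

theorem IsWellComplementedWith.exists_isBlockSystem {y : M → E} {C : ℝ}
    (h : q.IsWellComplementedWith x y C) (hn : q.IsNormalized y) :
    ∃ y' : M → E →ₗ[𝕜] 𝕜, q.IsBlockSystem x y y' C := by
  obtain ⟨-, y', hp, hdual, hfin, hdis, hC⟩ := h
  refine ⟨y', hn, hp.apply_self, sum_le_of_mem_upperBounds hC, fun f ε hε => ?_, hdual, hfin,
    fun m k n hmk hm => ?_⟩
  · obtain ⟨P, -, hP⟩ := hp.projection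
    exact (hP f).exists_tail hε
  · by_contra hk
    exact Set.disjoint_left.1 (hdis m k hmk) hm hk

variable {y : M → E} {y' : M → E →ₗ[𝕜] 𝕜} {C : ℝ}

theorem IsBlockSystem.subtype (h : q.IsBlockSystem x y y' C) (p : M → Prop) :
    q.IsBlockSystem x (fun m : Subtype p => y m) (fun m => y' m) C := by
  classical
  refine ⟨fun m => h.norm_eq m, fun m => h.apply_self m, fun S f => ?_, fun f ε hε => ?_,
    fun m => h.coeff_ne m, fun m => h.finite m,
    fun m k n hmk => h.disjoint m k n fun e => hmk (Subtype.ext e)⟩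
  · simpa using h.sum_le (S.map (Function.Embedding.subtype p)) f
  · obtain ⟨A, hA⟩ := h.tail f ε hε
    refine ⟨A.subtype p, fun S hS => ?_⟩
    have h1 := hA (S.map (Function.Embedding.subtype p)) (by
      rw [Finset.disjoint_left] at hS ⊢
      intro m hm hmS
      obtain ⟨k, hk, rfl⟩ := Finset.mem_map.1 hmS
      exact hS (Finset.mem_subtype.2 hm) hk)
    simpa using h1

theorem IsBlockSystem.norm_apply_le (h : q.IsBlockSystem x y y' C) (m : M) (f : E) :
    ‖y' m f‖ ≤ C * q f := by
  have h1 := h.sum_le {m} f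
  rwa [Finset.sum_singleton, q.smul', h.norm_eq, mul_one] at h1

/-- Every term of the expansion of `f` is annihilated: `y' m` vanishes on basis vectors outside the
support of `y m`, and the coefficients of `f` vanish on it. Boundedness of `y' m` does the rest. -/
theorem IsBlockSystem.apply_eq_zero (h : q.IsBlockSystem x y y' C)
    (hx : q.IsUnconditionalBasis x) (m : M) {f : E}
    (hf : ∀ n, q.coeff x (y m) n ≠ 0 → q.coeff x f n = 0) : y' m f = 0 := by
  refine HasUncondSum.functional_eq_zero (hasUncondSum_coeff hx f) (h.norm_apply_le m) fun n => ?_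
  rw [map_smul]
  by_cases hn : y' m (x n) = 0
  · rw [hn, smul_zero]
  · rw [hf n (h.coeff_ne m n hn), zero_smul]

end

end QuasiNorm

open QuasiNorm

/-! ### Strong absoluteness yields one large component. -/

section DirectSum

variable {𝕜 J : Type*} [RCLike 𝕜] {X : J → Type*} [∀ j, AddCommGroup (X j)]
  [∀ j, Module 𝕜 (X j)] {L : SequenceSpace 𝕜 J} {q : ∀ j, QuasiNorm 𝕜 (X j)} {κ : ℝ}
  {hκ : ∀ j, (q j).ModulusLE κ}

/-- The condition `0 < C` stands after `δ`, so that `δ` can be chosen as a function of all real `C`;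
its value for `C ≤ 0` is immaterial. -/
theorem exists_le_norm_apply_incl (hL : L.qnorm.IsStronglyAbsolute L.unitVector)
    (q : ∀ j, QuasiNorm 𝕜 (X j)) (κ : ℝ) (hκ : ∀ j, (q j).ModulusLE κ) (C : ℝ) :
    ∃ δ > 0, 0 < C → ∀ (φ : directSum L q κ hκ →ₗ[𝕜] 𝕜) (y : directSum L q κ hκ),
      (∀ f, ‖φ f‖ ≤ C * directSumNorm L q κ hκ f) → directSumNorm L q κ hκ y = 1 → φ y = 1 →
      ∃ j, δ ≤ ‖φ (directSumIncl L q κ hκ j ((y : ∀ j, X j) j))‖ := by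
  by_cases hC : 0 < C
  swap
  · exact ⟨1, one_pos, fun h => absurd h hC⟩
  -- With `‖b‖ ≤ C`, the alternative `‖b‖ / (4C)` is at most `1/4`, while `∑ |b j|` exceeds `1/2`.
  -- Hence `R * sup |b j| > 1/2`, which explains `δ = 1/(2R)`.
  obtain ⟨R, hR, habs⟩ := hL.2 (4 * C) (by positivity)
  refine ⟨1 / (2 * R), by positivity, fun _ φ y hφ hy hφy => ?_⟩
  obtain ⟨b, hb⟩ : ∃ b : L.carrier, ∀ j,
      (b : J → 𝕜) j = φ (directSumIncl L q κ hκ j ((y : ∀ j, X j) j)) := by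
    refine ⟨⟨fun j => φ (directSumIncl L q κ hκ j ((y : ∀ j, X j) j)),
      L.mem_of_le _ ((C : 𝕜) • normVec y : L.carrier) (fun j => ?_) (Subtype.prop _)⟩,
      fun _ => rfl⟩
    rw [Submodule.coe_smul, Pi.smul_apply, norm_smul, norm_normVec, RCLike.norm_ofReal,
      abs_of_pos hC]
    exact (hφ _).trans_eq (by rw [directSumNorm_incl])
  have hbn : L.qnorm b ≤ C := by
    have h1 := L.qnorm_le b ((C : 𝕜) • normVec y) (fun j => by
      rw [hb, Submodule.coe_smul, Pi.smul_apply, norm_smul, norm_normVec, RCLike.norm_ofReal,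
        abs_of_pos hC]
      exact (hφ _).trans_eq (by rw [directSumNorm_incl]))
    rw [L.qnorm.smul', RCLike.norm_ofReal, abs_of_pos hC] at h1
    have h2 : L.qnorm (normVec y) = 1 := hy
    rwa [h2, mul_one] at h1
  have h1 := (hasUncondSum_incl hL.1 y).map (q := scalar 𝕜) φ hφ
  rw [hφy] at h1
  obtain ⟨S, hS⟩ := hasUncondSum_iff.1 h1 (1 / 2) (by norm_num)
  have h2 : 1 / 2 < ∑ j ∈ S, ‖(b : J → 𝕜) j‖ := by
    have h3 : ‖∑ j ∈ S, (b : J → 𝕜) j - 1‖ < 1 / 2 := by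
      simp only [hb]
      exact hS S subset_rfl
    have h4 := norm_sum_le S (b : J → 𝕜)
    have h5 := norm_sub_norm_le (1 : 𝕜) (∑ j ∈ S, (b : J → 𝕜) j)
    rw [norm_one, norm_sub_rev] at h5
    linarith
  have h3 := habs b
  simp only [L.coeff_unitVector hL.1, L.qnorm_unitVector, mul_one] at h3
  have h4 : ENNReal.ofReal (1 / 2) < ∑' j, ENNReal.ofReal ‖(b : J → 𝕜) j‖ := by
    refine lt_of_lt_of_le ?_ (ENNReal.sum_le_tsum S)
    rw [← ENNReal.ofReal_sum_of_nonneg fun _ _ => norm_nonneg _]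
    exact (ENNReal.ofReal_lt_ofReal_iff (by linarith)).2 h2
  rcases lt_max_iff.1 (h4.trans_le h3) with h5 | h5
  · rw [ENNReal.mul_iSup, lt_iSup_iff] at h5
    obtain ⟨j, hj⟩ := h5
    rw [← ENNReal.ofReal_mul hR.le, ENNReal.ofReal_lt_ofReal_iff'] at hj
    refine ⟨j, ?_⟩
    rw [← hb, div_le_iff₀ (by positivity)]
    linarith [hj.1]
  · rw [ENNReal.ofReal_lt_ofReal_iff'] at h5
    have h6 : L.qnorm b / (4 * C) ≤ 1 / 4 := by
      rw [div_le_iff₀ (by positivity)]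
      linarith
    linarith [h5.1]

theorem directSum_sum_smul_apply {M : Type*} [DecidableEq J] {i : M → J}
    {w : M → directSum L q κ hκ} (hw : ∀ m j, i m ≠ j → (w m : ∀ j, X j) j = 0) (S : Finset M)
    (a : M → 𝕜) (j : J) :
    ((∑ m ∈ S, a m • w m : directSum L q κ hκ) : ∀ j, X j) j =
      ∑ m ∈ S.subtype (fun m => i m = j), a m • (w m : ∀ j, X j) j := by
  rw [directSum_sum_apply,
    Finset.sum_subtype_eq_sum_filter (p := fun m => i m = j) fun m => a m • (w m : ∀ j, X j) j,
    Finset.sum_filter]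
  refine Finset.sum_congr rfl fun m _ => ?_
  split_ifs with h
  · rfl
  · rw [Submodule.coe_smul, Pi.smul_apply, hw m j h, smul_zero]

variable {N : J → Type*} {x : ∀ j, N j → X j} {D : ℝ}

theorem norm_coeff_incl_le (hL : L.qnorm.IsUnconditionalBasis L.unitVector)
    (hx : ∀ j, (q j).IsUnconditionalBasis (x j)) (hD : 0 ≤ D)
    (hlat : ∀ j, (q j).IsLatticeWith (x j) D) (f : directSum L q κ hκ) (j : J) (i : Σ j, N j) :
    ‖(directSumNorm L q κ hκ).coeff (directSumBasis L q κ hκ x)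
      (directSumIncl L q κ hκ j ((f : ∀ j, X j) j)) i‖ ≤
    ‖(directSumNorm L q κ hκ).coeff (directSumBasis L q κ hκ x) f i‖ := by
  rw [coeff_directSumBasis hL hx hD hlat, coeff_directSumBasis hL hx hD hlat]
  obtain ⟨k, n⟩ := i
  by_cases hk : k = j
  · subst hk
    rw [directSumIncl_self]
  · have : (q k).coeff (x k) 0 = 0 := _root_.map_zero (coeffMap (hx k))
    simp only [directSumIncl_ne hk, this, Pi.zero_apply, norm_zero]
    exact norm_nonneg _

/-! ### Components of blocks in one summand. -/

section Component

variable {M : Type*} {y : M → directSum L q κ hκ}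
  {y' : M → directSum L q κ hκ →ₗ[𝕜] 𝕜} {C δ : ℝ}

/-- Normalizing the chosen component thus costs only a factor controlled by `C` and `δ`. -/
theorem QuasiNorm.IsBlockSystem.component_bounds
    (h : (directSumNorm L q κ hκ).IsBlockSystem (directSumBasis L q κ hκ x) y y' C)
    {m : M} {j : J}
    (hδ : δ ≤ ‖y' m (directSumIncl L q κ hκ j ((y m : ∀ j, X j) j))‖) :
    q j ((y m : ∀ j, X j) j) ≤ 1 ∧ δ ≤ C * q j ((y m : ∀ j, X j) j) := by
  refine ⟨(apply_le_directSumNorm (y m) j).trans_eq (h.norm_eq m), hδ.trans ?_⟩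
  exact (h.norm_apply_le m _).trans_eq (by rw [directSumNorm_incl])

theorem QuasiNorm.IsBlockSystem.component_apply_ne (hL : L.qnorm.IsUnconditionalBasis L.unitVector)
    (hx : ∀ j, (q j).IsUnconditionalBasis (x j)) (hD : 0 ≤ D)
    (hlat : ∀ j, (q j).IsLatticeWith (x j) D)
    (h : (directSumNorm L q κ hκ).IsBlockSystem (directSumBasis L q κ hκ x) y y' C)
    {m k : M} (hmk : m ≠ k) (j : J) :
    y' m (directSumIncl L q κ hκ j ((y k : ∀ j, X j) j)) = 0 := by
  refine h.apply_eq_zero (directSumBasis_isUnconditionalBasis hL hx hD hlat) m fun i hi => ?_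
  have h1 := norm_coeff_incl_le hL hx hD hlat (y k) j i
  rw [h.disjoint m k i hmk hi, norm_zero] at h1
  exact norm_le_zero_iff.1 h1

theorem QuasiNorm.IsBlockSystem.component_isWellComplementedWith
    (hL : L.qnorm.IsUnconditionalBasis L.unitVector)
    (hx : ∀ j, (q j).IsUnconditionalBasis (x j)) (hD : 0 ≤ D)
    (hlat : ∀ j, (q j).IsLatticeWith (x j) D)
    (h : (directSumNorm L q κ hκ).IsBlockSystem (directSumBasis L q κ hκ x) y y' C)
    {j : J} (hq : (q j).IsComplete) {κ' : ℝ} (hκ' : (q j).ModulusLE κ') (h0 : 0 ≤ κ')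
    (hδ0 : 0 < δ)
    (hδ : ∀ m, δ ≤ ‖y' m (directSumIncl L q κ hκ j ((y m : ∀ j, X j) j))‖) :
    (q j).IsWellComplementedWith (x j)
      (fun m => (((q j ((y m : ∀ j, X j) j))⁻¹ : ℝ) : 𝕜) • (y m : ∀ j, X j) j)
      (κ' * |D * δ⁻¹ * C|) := by
  have hρ : ∀ m, q j ((y m : ∀ j, X j) j) ≠ 0 := fun m h1 => by
    have h2 := (h.component_bounds (hδ m)).2
    rw [h1, mul_zero] at h2
    exact absurd hδ0 (not_lt.2 h2)
  have hρ' : ∀ m, ((q j ((y m : ∀ j, X j) j) : ℝ) : 𝕜) ≠ 0 := fun m => by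
    exact_mod_cast hρ m
  have hlam : ∀ m, y' m (directSumIncl L q κ hκ j ((y m : ∀ j, X j) j)) ≠ 0 := fun m =>
    norm_pos_iff.1 (hδ0.trans_le (hδ m))
  -- Scaled to be biorthogonal to the normalized components. In `v' m f • v m` the quasi-norm of the
  -- component cancels, leaving a factor `(y' m (L_j ((y m) j)))⁻¹` of modulus at most `δ⁻¹`.
  let v' : M → X j →ₗ[𝕜] 𝕜 := fun m =>
    (((q j ((y m : ∀ j, X j) j) : ℝ) : 𝕜) *
      (y' m (directSumIncl L q κ hκ j ((y m : ∀ j, X j) j)))⁻¹) •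
      (y' m).comp (directSumInclMap L q κ hκ j)
  have hv' : ∀ m f, v' m f = (((q j ((y m : ∀ j, X j) j) : ℝ) : 𝕜) *
      (y' m (directSumIncl L q κ hκ j ((y m : ∀ j, X j) j)))⁻¹) *
        y' m (directSumIncl L q κ hκ j f) := fun m f => rfl
  have hdis : ∀ m k n, m ≠ k → (q j).coeff (x j) ((y m : ∀ j, X j) j) n ≠ 0 →
      (q j).coeff (x j) ((y k : ∀ j, X j) j) n = 0 := fun m k n hmk hm => by
    have h1 := h.disjoint m k ⟨j, n⟩ hmk
    simp only [coeff_directSumBasis hL hx hD hlat] at h1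
    exact h1 hm
  have hsupp : ∀ m n, n ∈ (q j).supp (x j)
      ((((q j ((y m : ∀ j, X j) j))⁻¹ : ℝ) : 𝕜) • (y m : ∀ j, X j) j) ↔
      (q j).coeff (x j) ((y m : ∀ j, X j) j) n ≠ 0 := fun m n => by
    simp [supp, coeff_smul (hx j), hρ m]
  -- The sum is dominated by the `j`-th coordinate of a partial sum for `y`, so both the bound and
  -- the small tails are inherited from the block system.
  have hle : ∀ (S : Finset M) f, q j (∑ m ∈ S, v' m f •
      ((((q j ((y m : ∀ j, X j) j))⁻¹ : ℝ) : 𝕜) • (y m : ∀ j, X j) j)) ≤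
      D * δ⁻¹ * directSumNorm L q κ hκ
        (∑ m ∈ S, y' m (directSumIncl L q κ hκ j f) • y m) := by
    intro S f
    simp only [smul_smul]
    refine ((hlat j).sum_smul_le (hx j) S
      (b := fun m => y' m (directSumIncl L q κ hκ j f)) (inv_nonneg.2 hδ0.le)
      (fun m => ?_) hdis).trans (mul_le_mul_of_nonneg_left ?_ (by positivity))
    · have e : v' m f * (((q j ((y m : ∀ j, X j) j))⁻¹ : ℝ) : 𝕜) =
          (y' m (directSumIncl L q κ hκ j ((y m : ∀ j, X j) j)))⁻¹ *
            y' m (directSumIncl L q κ hκ j f) := by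
        rw [hv', RCLike.ofReal_inv]
        have := hρ' m
        field_simp
      rw [e, norm_mul, norm_inv]
      exact mul_le_mul_of_nonneg_right (inv_anti₀ hδ0 (hδ m)) (norm_nonneg _)
    · have h1 := apply_le_directSumNorm
        (∑ m ∈ S, y' m (directSumIncl L q κ hκ j f) • y m) j
      rw [directSum_sum_apply] at h1
      exact h1
  have hsum : ∀ (S : Finset M) f, q j (∑ m ∈ S, v' m f •
      ((((q j ((y m : ∀ j, X j) j))⁻¹ : ℝ) : 𝕜) • (y m : ∀ j, X j) j)) ≤
      D * δ⁻¹ * C * q j f := by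
    intro S f
    rw [mul_assoc]
    refine (hle S f).trans (mul_le_mul_of_nonneg_left ?_ (by positivity))
    exact (h.sum_le S _).trans_eq (by rw [directSumNorm_incl])
  have hp := isProjecting_of_finite hq hκ' h0
    (y := fun m => (((q j ((y m : ∀ j, X j) j))⁻¹ : ℝ) : 𝕜) • (y m : ∀ j, X j) j) (y' := v')
    (C := D * δ⁻¹ * C) ?_ ?_ ?_ hsum ?_
  · refine ⟨hp.1.isUnconditionalBasicSequence, v', hp.1, fun m n hn => ?_, fun m => ?_,
      fun m k hmk => ?_, hp.2⟩
    · rw [hsupp, ← coeff_directSumBasis hL hx hD hlat (y m) ⟨j, n⟩]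
      exact h.coeff_ne m ⟨j, n⟩ (right_ne_zero_of_mul hn)
    · refine ((h.finite m).preimage (f := Sigma.mk j) sigma_mk_injective.injOn).subset fun n hn => ?_
      rw [hsupp, ← coeff_directSumBasis hL hx hD hlat (y m) ⟨j, n⟩] at hn
      exact hn
    · refine Set.disjoint_left.2 fun n hn hn' => ?_
      rw [hsupp] at hn hn'
      exact hn' (hdis m k n hmk hn)
  · intro m
    refine ⟨‖((q j ((y m : ∀ j, X j) j) : ℝ) : 𝕜) *
      (y' m (directSumIncl L q κ hκ j ((y m : ∀ j, X j) j)))⁻¹‖ * C, fun f => ?_⟩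
    rw [hv', norm_mul, mul_assoc]
    refine mul_le_mul_of_nonneg_left ?_ (norm_nonneg _)
    exact (h.norm_apply_le m _).trans_eq (by rw [directSumNorm_incl])
  · intro m
    rw [map_smul, hv', smul_eq_mul, RCLike.ofReal_inv, inv_mul_cancel_right₀ (hlam m),
      inv_mul_cancel₀ (hρ' m)]
  · intro m k hmk
    rw [map_smul, hv', h.component_apply_ne hL hx hD hlat hmk, mul_zero, smul_zero]
  · intro f ε hε
    obtain ⟨A, hA⟩ := h.tail (directSumIncl L q κ hκ j f) (ε / (D * δ⁻¹ + 1)) (by positivity)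
    refine ⟨A, fun S hS => (hle S f).trans_lt ?_⟩
    have h1 : 0 ≤ directSumNorm L q κ hκ
      (∑ m ∈ S, y' m (directSumIncl L q κ hκ j f) • y m) := nonneg' _ _
    have h2 := hA S hS
    rw [lt_div_iff₀ (by positivity)] at h2
    nlinarith

end Component

/-! ### Transferring universality from the summands to the direct sum. -/

section Universal

variable {M : Type} {y : M → directSum L q κ hκ}
  {y' : M → directSum L q κ hκ →ₗ[𝕜] 𝕜} {C δ : ℝ}

theorem QuasiNorm.IsBlockSystem.exists_component_map [Countable M]
    (hL : L.qnorm.IsUnconditionalBasis L.unitVector)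
    (hx : ∀ j, (q j).IsUnconditionalBasis (x j)) (hD : 0 ≤ D)
    (hlat : ∀ j, (q j).IsLatticeWith (x j) D)
    (h : (directSumNorm L q κ hκ).IsBlockSystem (directSumBasis L q κ hκ x) y y' C)
    (hC : 0 ≤ C) {j : J} (hq : (q j).IsComplete) {κ' : ℝ} (hκ' : (q j).ModulusLE κ') (h0 : 0 ≤ κ')
    (hδ0 : 0 < δ)
    (hδ : ∀ m, δ ≤ ‖y' m (directSumIncl L q κ hκ j ((y m : ∀ j, X j) j))‖)
    {η : ℝ → ℝ} (hη : (q j).IsUniformlyUniversalWith (x j) η) :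
    ∃ π : M → N j,
      (∀ m, (directSumNorm L q κ hκ).coeff (directSumBasis L q κ hκ x) (y m) ⟨j, π m⟩ ≠ 0) ∧
      ∀ (S : Finset M) (a : M → 𝕜),
        q j (∑ m ∈ S, a m • (y m : ∀ j, X j) j) ≤
          η (max 1 (κ' * |D * δ⁻¹ * C|)) * D * (1 + C / δ) * q j (∑ m ∈ S, a m • x j (π m)) ∧
        q j (∑ m ∈ S, a m • x j (π m)) ≤
          η (max 1 (κ' * |D * δ⁻¹ * C|)) * D * (1 + C / δ) *
            q j (∑ m ∈ S, a m • (y m : ∀ j, X j) j) := by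
  classical
  have hb : ∀ m, q j ((y m : ∀ j, X j) j) ≤ 1 ∧ δ ≤ C * q j ((y m : ∀ j, X j) j) :=
    fun m => h.component_bounds (hδ m)
  have hρ : ∀ m, 0 < q j ((y m : ∀ j, X j) j) := fun m => by
    by_contra h1
    have h2 := mul_nonpos_of_nonneg_of_nonpos hC (not_lt.1 h1)
    linarith [(hb m).2]
  have hρ' : ∀ m, ((q j ((y m : ∀ j, X j) j) : ℝ) : 𝕜) ≠ 0 := fun m => by
    exact_mod_cast (hρ m).ne'
  obtain ⟨h1, y'', hp, hd, hf, hdj, hub⟩ :=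
    h.component_isWellComplementedWith hL hx hD hlat hq hκ' h0 hδ0 hδ
  obtain ⟨π, hπ, heq⟩ := hη.2 (max 1 (κ' * |D * δ⁻¹ * C|)) (le_max_left _ _) M
    (fun m => (((q j ((y m : ∀ j, X j) j))⁻¹ : ℝ) : 𝕜) • (y m : ∀ j, X j) j)
    (fun m => by
      rw [(q j).smul', RCLike.norm_ofReal, abs_of_pos (inv_pos.2 (hρ m)),
        inv_mul_cancel₀ (hρ m).ne'])
    ⟨h1, y'', hp, hd, hf, hdj, fun r hr => (hub hr).trans (le_max_right _ _)⟩
  have hη1 := hη.1 (max 1 (κ' * |D * δ⁻¹ * C|)) (le_max_left _ _)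
  generalize η (max 1 (κ' * |D * δ⁻¹ * C|)) = t at heq hη1 ⊢
  -- Injectivity follows from `π m` lying in disjoint supports; it makes the vectors `x j (π m)`
  -- disjointly supported, as `sum_smul_le` requires.
  have hinj : Function.Injective π := fun m k hmk => by
    by_contra hne
    exact Set.disjoint_left.1 (hdj m k hne) (hπ m) (hmk ▸ hπ k)
  have hdx : ∀ m k n, m ≠ k → (q j).coeff (x j) (x j (π m)) n ≠ 0 →
      (q j).coeff (x j) (x j (π k)) n = 0 := fun m k n hmk hm => by
    rw [coeff_basis (hx j)] at hm ⊢
    have e : n = π m := by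
      by_contra e
      exact hm (Pi.single_eq_of_ne e _)
    exact Pi.single_eq_of_ne (fun e' => hmk (hinj (e.symm.trans e'))) _
  refine ⟨π, fun m => ?_, fun S a => ?_⟩
  · have h2 := hπ m
    rw [coeff_directSumBasis hL hx hD hlat]
    simp only [supp, Set.mem_ofPred_eq, coeff_smul (hx j), Pi.smul_apply] at h2
    exact right_ne_zero_of_smul h2
  -- Coefficients are multiplied by the quasi-norm of the component to undo the normalization. That
  -- factor lies between `δ / C` and `1`, and `1 + C / δ` covers both directions.
  · have h3 := heq.sum_le S (fun m => a m * ((q j ((y m : ∀ j, X j) j) : ℝ) : 𝕜))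
    have e : ∀ m, (a m * ((q j ((y m : ∀ j, X j) j) : ℝ) : 𝕜)) •
        ((((q j ((y m : ∀ j, X j) j))⁻¹ : ℝ) : 𝕜) • (y m : ∀ j, X j) j) =
        a m • (y m : ∀ j, X j) j := fun m => by
      rw [smul_smul, RCLike.ofReal_inv, mul_inv_cancel_right₀ (hρ' m)]
    simp only [e] at h3
    have hn : ∀ m, ‖a m * ((q j ((y m : ∀ j, X j) j) : ℝ) : 𝕜)‖ =
        ‖a m‖ * q j ((y m : ∀ j, X j) j) := fun m => by
      rw [norm_mul, RCLike.norm_ofReal, abs_of_pos (hρ m)]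
    have h4 := (hlat j).sum_smul_le (hx j) S (w := fun m => x j (π m))
      (a := fun m => a m * ((q j ((y m : ∀ j, X j) j) : ℝ) : 𝕜)) (b := a) zero_le_one
      (fun m => by
        rw [hn, one_mul]
        exact mul_le_of_le_one_right (norm_nonneg _) (hb m).1) hdx
    have h5 := (hlat j).sum_smul_le (hx j) S (w := fun m => x j (π m))
      (b := fun m => a m * ((q j ((y m : ∀ j, X j) j) : ℝ) : 𝕜)) (a := a) (t := C / δ)
      (by positivity)
      (fun m => by
        rw [hn, div_mul_eq_mul_div, le_div_iff₀ hδ0]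
        calc ‖a m‖ * δ ≤ ‖a m‖ * (C * q j ((y m : ∀ j, X j) j)) :=
              mul_le_mul_of_nonneg_left (hb m).2 (norm_nonneg _)
          _ = _ := by ring) hdx
    have hCδ : 0 ≤ C / δ := by positivity
    have ht0 : 0 ≤ t := by linarith
    have n1 := (q j).nonneg' (∑ m ∈ S, a m • x j (π m))
    have n2 := (q j).nonneg' (∑ m ∈ S, a m • (y m : ∀ j, X j) j)
    constructor
    · calc _ ≤ t * (D * 1 * q j (∑ m ∈ S, a m • x j (π m))) :=
            h3.2.trans (mul_le_mul_of_nonneg_left h4 ht0)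
        _ = t * D * 1 * q j (∑ m ∈ S, a m • x j (π m)) := by ring
        _ ≤ _ := mul_le_mul_of_nonneg_right
            (mul_le_mul_of_nonneg_left (by linarith) (by positivity)) n1
    · calc _ ≤ D * (C / δ) * (t * q j (∑ m ∈ S, a m • (y m : ∀ j, X j) j)) :=
            h5.trans (mul_le_mul_of_nonneg_left h3.1 (by positivity))
        _ = t * D * (C / δ) * q j (∑ m ∈ S, a m • (y m : ∀ j, X j) j) := by ring
        _ ≤ _ := mul_le_mul_of_nonneg_right
            (mul_le_mul_of_nonneg_left (by linarith) (by positivity)) n2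

/-- The first bound is coefficientwise domination. For the second, `y' m` kills the components of
the other blocks and multiplies `a m` by a scalar of modulus at least `δ`; that scalar is removed by
the lattice property. -/
theorem QuasiNorm.IsBlockSystem.sum_component_equiv (hL : L.qnorm.IsUnconditionalBasis L.unitVector)
    (hx : ∀ j, (q j).IsUnconditionalBasis (x j)) (hD : 0 ≤ D)
    (hlat : ∀ j, (q j).IsLatticeWith (x j) D)
    (h : (directSumNorm L q κ hκ).IsBlockSystem (directSumBasis L q κ hκ x) y y' C)
    (hδ0 : 0 < δ) {i : M → J}
    (hδ : ∀ m, δ ≤ ‖y' m (directSumIncl L q κ hκ (i m) ((y m : ∀ j, X j) (i m)))‖)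
    (S : Finset M) (a : M → 𝕜) :
    directSumNorm L q κ hκ
        (∑ m ∈ S, a m • directSumIncl L q κ hκ (i m) ((y m : ∀ j, X j) (i m))) ≤
      D * directSumNorm L q κ hκ (∑ m ∈ S, a m • y m) ∧
    directSumNorm L q κ hκ (∑ m ∈ S, a m • y m) ≤ D * (C / δ) * directSumNorm L q κ hκ
      (∑ m ∈ S, a m • directSumIncl L q κ hκ (i m) ((y m : ∀ j, X j) (i m))) := by
  classical
  have hZ := directSumBasis_isUnconditionalBasis (hκ := hκ) hL hx hD hlat
  have hZlat := directSumBasis_isLatticeWith (hκ := hκ) hL hx hD hlat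
  constructor
  · refine hZlat.sum_le hZ S (fun m n => ?_) (fun m k n hmk hm => ?_)
    · simp only [coeff_smul hZ, Pi.smul_apply, norm_smul]
      exact mul_le_mul_of_nonneg_left (norm_coeff_incl_le hL hx hD hlat _ _ _) (norm_nonneg _)
    · simp only [coeff_smul hZ, Pi.smul_apply] at hm ⊢
      rw [h.disjoint m k n hmk (right_ne_zero_of_smul hm), smul_zero]
  · have h1 := h.sum_le S
      (∑ m ∈ S, a m • directSumIncl L q κ hκ (i m) ((y m : ∀ j, X j) (i m)))
    have h2 : ∀ m ∈ S, y' m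
        (∑ m ∈ S, a m • directSumIncl L q κ hκ (i m) ((y m : ∀ j, X j) (i m))) =
        a m * y' m (directSumIncl L q κ hκ (i m) ((y m : ∀ j, X j) (i m))) := fun m hm => by
      rw [map_sum, Finset.sum_eq_single_of_mem m hm fun k _ hk => ?_, map_smul, smul_eq_mul]
      rw [map_smul, h.component_apply_ne hL hx hD hlat hk.symm, smul_zero]
    rw [Finset.sum_congr rfl fun m hm => by rw [h2 m hm]] at h1
    have h3 := hZlat.sum_smul_le hZ S (w := y) (a := a) (t := δ⁻¹) (inv_nonneg.2 hδ0.le)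
      (b := fun m => a m * y' m (directSumIncl L q κ hκ (i m) ((y m : ∀ j, X j) (i m))))
      (fun m => by
        rw [norm_mul, inv_mul_eq_div, le_div_iff₀ hδ0]
        exact mul_le_mul_of_nonneg_left (hδ m) (norm_nonneg _)) h.disjoint
    refine h3.trans ((mul_le_mul_of_nonneg_left h1 (by positivity)).trans_eq ?_)
    rw [div_eq_mul_inv]
    ring

theorem QuasiNorm.IsBlockSystem.exists_map [Countable M] (hL : L.qnorm.IsUnconditionalBasis L.unitVector)
    (hx : ∀ j, (q j).IsUnconditionalBasis (x j)) (hD : 0 < D)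
    (hlat : ∀ j, (q j).IsLatticeWith (x j) D)
    (h : (directSumNorm L q κ hκ).IsBlockSystem (directSumBasis L q κ hκ x) y y' C)
    (hC : 0 ≤ C) (hq : ∀ j, (q j).IsComplete) {κ' : ℝ} (hκ' : ∀ j, (q j).ModulusLE κ')
    (h0 : 0 ≤ κ') {κ₂ : ℝ} (hκ₂ : (directSumNorm L q κ hκ).ModulusLE κ₂) (h1 : 1 ≤ κ₂)
    (hδ0 : 0 < δ)
    (hδ : ∀ m, ∃ j, δ ≤ ‖y' m (directSumIncl L q κ hκ j ((y m : ∀ j, X j) j))‖)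
    {η : ℝ → ℝ} (hη : ∀ j, (q j).IsUniformlyUniversalWith (x j) η) :
    ∃ π : M → Σ j, N j,
      (∀ m, π m ∈ (directSumNorm L q κ hκ).supp (directSumBasis L q κ hκ x) (y m)) ∧
      AreEquivalentWith (directSumNorm L q κ hκ) (directSumNorm L q κ hκ) y
        (fun m => directSumBasis L q κ hκ x (π m))
        (κ₂ ^ 2 * (max 1 (η (max 1 (κ' * |D * δ⁻¹ * C|))) * D * (1 + C / δ) *
          (D * (1 + C / δ)))) := by
  classical
  choose i hi using hδ
  have hcomp := fun j =>
    (h.subtype (fun m => i m = j)).exists_component_map hL hx hD.le hlat hC (hq j) (hκ' j) h0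
      hδ0 (fun m => by obtain ⟨m, rfl⟩ := m; exact hi m) (hη j)
  choose π hπ hequiv using hcomp
  have hCδ : 0 ≤ C / δ := by positivity
  -- When `J` is empty nothing is known about `η`; the maximum with `1` keeps the constant positive.
  have ht := le_max_right 1 (η (max 1 (κ' * |D * δ⁻¹ * C|)))
  have ht1 := le_max_left 1 (η (max 1 (κ' * |D * δ⁻¹ * C|)))
  generalize max 1 (η (max 1 (κ' * |D * δ⁻¹ * C|))) = t at ht ht1 ⊢
  have ht0 : 0 < t := by linarith
  have hc : η (max 1 (κ' * |D * δ⁻¹ * C|)) * D * (1 + C / δ) ≤ t * D * (1 + C / δ) :=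
    mul_le_mul_of_nonneg_right (mul_le_mul_of_nonneg_right ht hD.le) (by linarith)
  refine ⟨fun m => ⟨i m, π (i m) ⟨m, rfl⟩⟩, fun m => hπ (i m) ⟨m, rfl⟩, ?_⟩
  refine areEquivalentWith_of_finite (directSumNorm_isComplete hL hq) hκ₂ hκ₂ h1
    (by positivity) fun S a => ?_
  have e1 : ∀ j, ((∑ m ∈ S, a m • directSumIncl L q κ hκ (i m) ((y m : ∀ j, X j) (i m)) :
      directSum L q κ hκ) : ∀ j, X j) j =
      ∑ m ∈ S.subtype (fun m => i m = j), a m • (y m : ∀ j, X j) j := fun j => by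
    refine (directSum_sum_smul_apply (i := i)
      (w := fun m => directSumIncl L q κ hκ (i m) ((y m : ∀ j, X j) (i m)))
      (fun m j hm => directSumIncl_ne (Ne.symm hm) _) S a j).trans (Finset.sum_congr rfl ?_)
    rintro ⟨m, rfl⟩ -
    rw [directSumIncl_self]
  have e2 : ∀ j, ((∑ m ∈ S, a m • directSumBasis L q κ hκ x ⟨i m, π (i m) ⟨m, rfl⟩⟩ :
      directSum L q κ hκ) : ∀ j, X j) j =
      ∑ m ∈ S.subtype (fun m => i m = j), a m • x j (π j m) := fun j => by
    refine (directSum_sum_smul_apply (i := i)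
      (w := fun m => directSumBasis L q κ hκ x ⟨i m, π (i m) ⟨m, rfl⟩⟩)
      (fun m j hm => directSumIncl_ne (Ne.symm hm) _) S a j).trans (Finset.sum_congr rfl ?_)
    rintro ⟨m, rfl⟩ -
    rw [directSumBasis, directSumIncl_self]
  have h2 := h.sum_component_equiv hL hx hD.le hlat hδ0 hi S a
  have h3 : directSumNorm L q κ hκ
      (∑ m ∈ S, a m • directSumIncl L q κ hκ (i m) ((y m : ∀ j, X j) (i m))) ≤
      t * D * (1 + C / δ) * directSumNorm L q κ hκ
      (∑ m ∈ S, a m • directSumBasis L q κ hκ x ⟨i m, π (i m) ⟨m, rfl⟩⟩) :=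
    directSumNorm_le_mul _ _ (by positivity) fun j => by
      rw [e1, e2]
      exact (hequiv j _ fun m => a m).1.trans
        (mul_le_mul_of_nonneg_right hc ((q j).nonneg' _))
  have h4 : directSumNorm L q κ hκ
      (∑ m ∈ S, a m • directSumBasis L q κ hκ x ⟨i m, π (i m) ⟨m, rfl⟩⟩) ≤
      t * D * (1 + C / δ) * directSumNorm L q κ hκ
      (∑ m ∈ S, a m • directSumIncl L q κ hκ (i m) ((y m : ∀ j, X j) (i m))) :=
    directSumNorm_le_mul _ _ (by positivity) fun j => by
      rw [e1, e2]
      exact (hequiv j _ fun m => a m).2.trans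
        (mul_le_mul_of_nonneg_right hc ((q j).nonneg' _))
  have n1 : 0 ≤ directSumNorm L q κ hκ (∑ m ∈ S, a m • y m) := nonneg' _ _
  have n2 : 0 ≤ directSumNorm L q κ hκ
      (∑ m ∈ S, a m • directSumIncl L q κ hκ (i m) ((y m : ∀ j, X j) (i m))) := nonneg' _ _
  constructor
  · refine h4.trans ?_
    rw [mul_assoc (t * D * (1 + C / δ))]
    refine mul_le_mul_of_nonneg_left (h2.1.trans (mul_le_mul_of_nonneg_right ?_ n1))
      (by positivity)
    exact le_mul_of_one_le_right hD.le (by linarith)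
  · refine h2.2.trans ?_
    calc _ ≤ D * (1 + C / δ) * directSumNorm L q κ hκ
          (∑ m ∈ S, a m • directSumIncl L q κ hκ (i m) ((y m : ∀ j, X j) (i m))) :=
          mul_le_mul_of_nonneg_right (mul_le_mul_of_nonneg_left (by linarith) hD.le) n2
      _ ≤ _ := mul_le_mul_of_nonneg_left h3 (by positivity)
      _ = _ := by ring

end Universal

end DirectSum

end QuasiBanach
end

/-! ### The theorem. -/

theorem mainTheorem4 {𝕜 : Type*} [RCLike 𝕜] {J : Type*} [Countable J]
    {N : J → Type*} [∀ j, Countable (N j)]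
    {X : J → Type*} [∀ j, AddCommGroup (X j)] [∀ j, Module 𝕜 (X j)]
    (L : QuasiBanach.SequenceSpace 𝕜 J) (hL : L.qnorm.IsStronglyAbsolute L.unitVector)
    (q : ∀ j, QuasiBanach.QuasiNorm 𝕜 (X j)) (hq : ∀ j, (q j).IsComplete)
    (κ : ℝ) (hκ : ∀ j, (q j).ModulusLE κ)
    (K : ℝ) (x : ∀ j, N j → X j)
    (hbasis : ∀ j, (q j).IsUnconditionalBasis (x j))
    (hnorm : ∀ j, (q j).IsNormalized (x j))
    (hK : ∀ j, (q j).IsUnconditionalWith (x j) K)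
    (η : ℝ → ℝ) (hη : ∀ j, (q j).IsUniformlyUniversalWith (x j) η) :
    (QuasiBanach.directSumNorm L q κ hκ).IsComplete ∧
    (QuasiBanach.directSumNorm L q κ hκ).IsUnconditionalBasis
      (QuasiBanach.directSumBasis L q κ hκ x) ∧
    (QuasiBanach.directSumNorm L q κ hκ).IsNormalized
      (QuasiBanach.directSumBasis L q κ hκ x) ∧
    (QuasiBanach.directSumNorm L q κ hκ).IsUniformlyUniversal
      (QuasiBanach.directSumBasis L q κ hκ x) := by
  -- The bound `κ` may be less than `1`, and `1 ≤ K` is unavailable for empty `J`; hence the maxima.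
  have hk1 : (1 : ℝ) ≤ max κ 1 := le_max_right _ _
  have hκ1 : ∀ j, (q j).ModulusLE (max κ 1) := fun j => (hκ j).mono (le_max_left _ _)
  have hD : 0 < max κ 1 ^ 2 * max K 1 := by positivity
  have hlat : ∀ j, (q j).IsLatticeWith (x j) (max κ 1 ^ 2 * max K 1) := fun j =>
    ((hK j).isLatticeWith (hbasis j) (hκ1 j) hk1).mono
      (mul_le_mul_of_nonneg_left (le_max_left _ _) (by positivity))
  refine ⟨QuasiBanach.directSumNorm_isComplete hL.1 hq,
    QuasiBanach.directSumBasis_isUnconditionalBasis hL.1 hbasis hD.le hlat,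
    QuasiBanach.directSumBasis_isNormalized hnorm, ?_⟩
  obtain ⟨κ₂, h1, hκ₂⟩ := (QuasiBanach.directSumNorm L q κ hκ).add_le'
  choose δ hδ0 hδ using QuasiBanach.exists_le_norm_apply_incl hL q κ hκ
  generalize max κ 1 ^ 2 * max K 1 = D at hD hlat
  -- All the ingredients `κ₂`, `D` and `δ C` are independent of the block sequence, so this is a
  -- legitimate function of `C`.
  refine ⟨fun C => max 1 (κ₂ ^ 2 * (max 1 (η (max 1 (max κ 1 * |D * (δ C)⁻¹ * C|))) * D *
    (1 + C / δ C) * (D * (1 + C / δ C)))), fun _ _ => le_max_left _ _, ?_⟩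
  intro C hC M _ y hyn hy
  have hC0 : 0 < C := by linarith
  obtain ⟨y', hy'⟩ := hy.exists_isBlockSystem hyn
  obtain ⟨π, hπ, he⟩ := hy'.exists_map hL.1 hbasis hD hlat hC0.le hq
    hκ1 (by linarith) hκ₂ h1 (hδ0 C)
    (fun m => hδ C hC0 (y' m) (y m) (hy'.norm_apply_le m) (hy'.norm_eq m) (hy'.apply_self m)) hη
  exact ⟨π, hπ, he.mono (le_max_right _ _)⟩
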